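/- Let $k,m\ge 1$ be integers, $\mathcal X_{k,m}=\{\eta=(k_1,\dots,k_m)\in\mathbb N^m : k_1+\cdots+k_m=k\}$ and, for $j=1,\dots,m$, let $\phi_j:\mathbb N\to\mathbb R\cup\{-\infty\}$ be such that $e^{\phi_j}$ is log-concave, i.e. $\{x:\phi_j(x)>-\infty\}$ is an interval of $\mathbb N$ and $e^{2\phi_j(x)}\ge e^{\phi_j(x-1)}e^{\phi_j(x+1)}$ for all $x\ge 1$. Assume that $Q=\sum_{\eta\in\mathcal X_{k,m}}\prod_j e^{\phi_j(k_j)}>0$, and let $\nu$ be the probability measure $\nu(\eta)=Q^{-1}\prod_{j}e^{\phi_j(k_j)}$ on $\mathcal X_{k,m}$. For $\lambda\in[0,1]$ let $$\psi_j^{[\lambda]}(x)=\phi_j(x+1)-\phi_j(x)+\lambda\ln(1+x),\qquad x\in\mathbb N,$$ where $-\infty-(-\infty)$ is read as $+\infty$ below and as $-\infty$ above the support of $e^{\phi_j}$, and $\psi_j^{[\lambda]}(-1)=+\infty$. Let $\delta$ be the largest $\lambda\in[0,1]$ for which all the functions $\psi_1^{[\lambda]},\dots,\psi_m^{[\lambda]}$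 are non-increasing on $\mathbb N$, and assume $\delta>0$. Put $l_\delta=k^\delta(k\wedge m)^{1-\delta}$. For $i\ne j$ and $\eta$ with $k_i\geq 1$ let $\eta^{ij}$ be the configuration obtained from $\eta$ by replacing $k_i$ by $k_i-1$ and $k_j$ by $k_j+1$. On $\mathcal X_{k,m}\setminus\nu^{-1}\{0\}$ define $$p(\eta,\eta^{ij})=\frac{k_i^\delta}{l_\delta}\,\frac1m\,\exp\Big\{-\big[\psi_i^{[\delta]}(k_i-1)-\psi_j^{[\delta]}(k_j)\big]^+\Big\}\quad(i\neq j),\qquad p(\eta,\eta)=1-\sum_{i\ne j}p(\eta,\eta^{ij}),$$ where $p(\eta,\eta^{ij})=0$ if $k_i=0$, and $p(\eta,\eta')=0$ for all other $\eta'$. Then $p$ is a stochastic matrix on $\mathcal X_{k,m}\setminus\nu^{-1}\{0\}$, the Markov chain with transition matrix $p$ is reversible with respect to $\nu$, and the following holds for every $\epsilon\in(0,1)$. Let $d(t)=\max_{\eta}\|p^t(\eta,\cdot)-\nu\|_{\rm TV}$ for $t\in\mathbb N$ (maximum over $\eta$ with $\nu(\eta)>0$), $t_\epsilon=\min\{t\in\mathbb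 N: d(t)\le\epsilon\}$, and $$B_\epsilon=\frac{(k\wedge m)^{1-\delta}}{\delta}\,k\,m\,\ln(k/\epsilon).$$ Then $d(t)\le\epsilon$ for every integer $t\ge B_\epsilon$, so that $t_\epsilon\le\lceil B_\epsilon\rceil$; and if $k\ge 2$, then $t_\epsilon\le B_\epsilon$. -/

import Mathlib

open scoped NNReal ENNReal

noncomputable section

namespace LogConcaveChain

/-- A measure `γ` on the integers (given by its point masses) is log-concave: its support is an
interval of the integers and `γ(x)² ≥ γ(x-1) γ(x+1)` for all `x ≥ 1`. -/
def LogConcave (γ : ℕ → ℝ≥0) : Prop :=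
  {x | γ x ≠ 0}.OrdConnected ∧ ∀ x : ℕ, 1 ≤ x → γ (x - 1) * γ (x + 1) ≤ γ x ^ 2

/-- The function `φ : ℕ → ℝ ∪ {-∞}` such that `γ = e^φ`. -/
def phi (γ : ℕ → ℝ≥0) (x : ℕ) : EReal := ENNReal.log (γ x : ℝ≥0∞)

/-- The discrete gradient `∇⁺φ(x) = φ(x+1) - φ(x)`, with values in `ℝ ∪ {±∞}`. Where both terms
are `-∞` it is extended by `+∞` below the support of `γ` and by `-∞` above it (the gradient is already
`+∞` at the step into the support and `-∞` at the step out of it). -/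
def gradPhi (γ : ℕ → ℝ≥0) (x : ℕ) : EReal :=
  open Classical in
  if γ x = 0 ∧ γ (x + 1) = 0 then
    (if ∃ y, x < y ∧ γ y ≠ 0 then ⊤ else ⊥)
  else phi γ (x + 1) - phi γ x

/-- `ψ^{[δ]} = ∇⁺φ + δ ln(1 + ·)`. -/
def psi (δ : ℝ) (γ : ℕ → ℝ≥0) (x : ℕ) : EReal :=
  gradPhi γ x + ((δ * Real.log (1 + (x : ℝ)) : ℝ) : EReal)

/-- The set of the `lam ∈ [0,1]` for which all the `ψ_j^{[lam]}` are non-increasing. -/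
def admissible {m : ℕ} (γ : Fin m → ℕ → ℝ≥0) : Set ℝ :=
  {lam | lam ∈ Set.Icc (0 : ℝ) 1 ∧ ∀ j, Antitone (psi lam (γ j))}

/-- The largest `δ ∈ [0,1]` for which all the `ψ_j^{[δ]}` are non-increasing
(it is attained, see `isGreatest_concavityIndex`). -/
def concavityIndex {m : ℕ} (γ : Fin m → ℕ → ℝ≥0) : ℝ := sSup (admissible γ)

theorem antitone_gradPhi {γ : ℕ → ℝ≥0} (h : LogConcave γ) : Antitone (gradPhi γ) := by
  refine antitone_nat_of_succ_le fun x => ?_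
  have hab : ∀ y, x + 1 < y → γ x ≠ 0 → γ (x + 1) = 0 → γ y = 0 := by
    intro y hy h0 h1
    by_contra h2
    exact h.1.out h0 h2 ⟨Nat.le_succ x, hy.le⟩ h1
  by_cases ha : γ x = 0
  · by_cases hb : γ (x + 1) = 0
    · by_cases hy : ∃ y, x < y ∧ γ y ≠ 0
      · simp [gradPhi, ha, hb, hy]
      · push Not at hy
        have h1 : ¬ ∃ y, x + 1 < y ∧ γ y ≠ 0 := by
          rintro ⟨y, hy1, hy2⟩
          exact hy2 (hy y (by omega))
        have h2 : γ (x + 1 + 1) = 0 := hy _ (by omega)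
        have : gradPhi γ (x + 1) = ⊥ := by
          unfold gradPhi
          rw [if_pos ⟨hb, h2⟩, if_neg h1]
        rw [this]
        exact bot_le
    · have : gradPhi γ x = ⊤ := by
        have hb' : phi γ (x + 1) ≠ ⊥ := by simp [phi, hb]
        unfold gradPhi
        rw [if_neg (by simp [hb])]
        have : phi γ x = ⊥ := by simp [phi, ha]
        rw [this, sub_eq_add_neg, EReal.neg_bot, EReal.add_top_of_ne_bot hb']
      rw [this]
      exact le_top
  · by_cases hb : γ (x + 1) = 0
    · have h1 : ¬ ∃ y, x + 1 < y ∧ γ y ≠ 0 := by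
        rintro ⟨y, hy1, hy2⟩
        exact hy2 (hab y hy1 ha hb)
      have : gradPhi γ (x + 1) = ⊥ := by
        unfold gradPhi
        rw [if_pos ⟨hb, hab _ (by omega) ha hb⟩, if_neg h1]
      rw [this]
      exact bot_le
    · have hreal : ∀ y, γ y ≠ 0 → phi γ y = ((Real.log (γ y) : ℝ) : EReal) := by
        intro y hy
        simp [phi, ENNReal.log, hy]
      have e1 : gradPhi γ x = phi γ (x + 1) - phi γ x := if_neg (by simp [ha])
      have e2 : gradPhi γ (x + 1) = phi γ (x + 1 + 1) - phi γ (x + 1) := if_neg (by simp [hb])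
      rw [e1, e2, hreal _ ha, hreal _ hb]
      by_cases hc : γ (x + 1 + 1) = 0
      · simp [phi, hc]
      · rw [hreal _ hc]
        norm_cast
        have hq : γ x * γ (x + 1 + 1) ≤ γ (x + 1) ^ 2 := by simpa using h.2 (x + 1) (by omega)
        have pa : (0 : ℝ) < γ x := by positivity
        have pb : (0 : ℝ) < γ (x + 1) := by positivity
        have pc : (0 : ℝ) < γ (x + 1 + 1) := by positivity
        have := Real.log_le_log (by positivity)
          (show (γ x : ℝ) * γ (x + 1 + 1) ≤ (γ (x + 1) : ℝ) ^ 2 by exact_mod_cast hq)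
        rw [Real.log_mul pa.ne' pc.ne', Real.log_pow] at this
        push_cast at this
        linarith

/-- `ψ^{[l]}` is non-increasing iff `-Δ_x φ ≥ l ln((1 + x)/x)` for all `x ≥ 1`, where `Δ_x φ` is
`φ(x+1) + φ(x-1) - 2 φ(x)`; the inequality is written without differences of infinite values. -/
theorem antitone_psi_iff {γ : ℕ → ℝ≥0} (h : LogConcave γ) (l : ℝ) :
  Antitone (psi l γ) ↔ ∀ x : ℕ,
      phi γ x + phi γ (x+2) + ((l * Real.log ((1+(x+1:ℝ))/(x+1)) : ℝ):EReal) ≤ phi γ (x+1) + phi γ (x+1) := by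
  have hg := antitone_gradPhi h
  have hreal : ∀ y, γ y ≠ 0 → phi γ y = ((Real.log (γ y) : ℝ) : EReal) := by
    intro y hy
    simp [phi, ENNReal.log, hy]
  have key : ∀ x, psi l γ (x+1) ≤ psi l γ x ↔ phi γ x + phi γ (x+2) + ((l * Real.log ((1+(x+1:ℝ))/(x+1)) : ℝ):EReal) ≤ phi γ (x+1) + phi γ (x+1) := by
    intro x
    have hx := hg (Nat.le_succ x)
    by_cases ha : γ x = 0
    · have h1 : gradPhi γ x = ⊤ ∨ gradPhi γ x = ⊥ := by
        by_cases hb : γ (x+1) = 0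
        · unfold gradPhi; rw [if_pos ⟨ha, hb⟩]; split_ifs <;> simp
        · left; unfold gradPhi; rw [if_neg (by simp [hb]), hreal _ hb]; simp [phi, ha]
      have h2 : phi γ x = ⊥ := by simp [phi, ha]
      refine iff_of_true ?_ (by simp [h2])
      rcases h1 with h1 | h1
      · simp only [psi, h1, EReal.top_add_coe]; exact le_top
      · rw [h1] at hx
        have : gradPhi γ (x+1) = ⊥ := le_bot_iff.1 hx
        simp [psi, this]
    · by_cases hc : γ (x+2) = 0
      · have h2 : phi γ (x+2) = ⊥ := by simp [phi, hc]
        refine iff_of_true ?_ (by simp [h2])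
        have : gradPhi γ (x+1) = ⊥ := by
          by_cases hb : γ (x+1) = 0
          · have : gradPhi γ x = ⊥ := by
              unfold gradPhi; rw [if_neg (by simp [ha]), hreal _ ha]; simp [phi, hb]
            rw [this] at hx; exact le_bot_iff.1 hx
          · unfold gradPhi; rw [if_neg (by simp [hb]), hreal _ hb]; simp [phi, hc]
        simp [psi, this]
      · have hb : γ (x+1) ≠ 0 := h.1.out ha hc ⟨by omega, by omega⟩
        have e1 : gradPhi γ x = phi γ (x + 1) - phi γ x := if_neg (by simp [ha])
        have e2 : gradPhi γ (x + 1) = phi γ (x + 1 + 1) - phi γ (x + 1) := if_neg (by simp [hb])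
        rw [psi, psi, e1, e2, hreal _ ha, hreal _ hb, hreal _ hc, Real.log_div (by positivity) (by positivity)]
        norm_cast
        push_cast
        have : (1+(x:ℝ)) = x+1 := by ring
        rw [this]
        constructor <;> intro h <;> linarith
  constructor
  · intro H x; exact (key x).1 (H (Nat.le_succ x))
  · intro H; exact antitone_nat_of_succ_le fun x => (key x).2 (H x)

/-- For log-concave factors the supremum defining `concavityIndex` is a maximum. -/
theorem isGreatest_concavityIndex {m : ℕ} {γ : Fin m → ℕ → ℝ≥0} (h : ∀ j, LogConcave (γ j)) :
    IsGreatest (admissible γ) (concavityIndex γ) := by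
  have h0 : (0 : ℝ) ∈ admissible γ := by
    refine ⟨by simp, fun j => ?_⟩
    have : psi 0 (γ j) = gradPhi (γ j) := by
      funext x
      simp [psi]
    rw [this]
    exact antitone_gradPhi (h j)
  have hcont : ∀ (c : EReal) (r : ℝ),
      Continuous fun lam : ℝ => c + ((lam * r : ℝ) : EReal) := by
    intro c r
    induction c with
    | bot => simp only [EReal.bot_add]; exact continuous_const
    | top => simp only [EReal.top_add_coe]; exact continuous_const
    | coe c =>
      have : Continuous fun lam : ℝ => c + lam * r := by fun_prop
      exact_mod_cast continuous_coe_real_ereal.comp (this : Continuous fun lam : ℝ => c + lam * r)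
  have hcl : IsClosed (admissible γ) := by
    have : admissible γ = Set.Icc 0 1 ∩ ⋂ j, ⋂ x, ⋂ y, ⋂ _ : x ≤ y,
        {lam | psi lam (γ j) y ≤ psi lam (γ j) x} := by
      ext lam
      simp [admissible, Antitone]
    rw [this]
    refine isClosed_Icc.inter (isClosed_iInter fun j => isClosed_iInter fun x =>
      isClosed_iInter fun y => isClosed_iInter fun _ => isClosed_le (hcont _ _) (hcont _ _))
  have hbdd : BddAbove (admissible γ) := ⟨1, fun _ hl => hl.1.2⟩
  exact ⟨hcl.csSup_mem ⟨0, h0⟩ hbdd, fun _ hl => le_csSup hbdd hl⟩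

/-- The configuration space `X_{k,m} = {(k_1,…,k_m) ∈ ℕ^m : k_1 + ⋯ + k_m = k}`. -/
def configs (m k : ℕ) : Finset (Fin m → ℕ) := Finset.piAntidiag Finset.univ k

/-- The normalization `Q` of the product of the `γ_j = e^{φ_j}` on `X_{k,m}`. -/
def partitionFn {m : ℕ} (γ : Fin m → ℕ → ℝ≥0) (k : ℕ) : ℝ :=
  ∑ η ∈ configs m k, ∏ j, (γ j (η j) : ℝ)

/-- The conditional product measure `ν(k_1,…,k_m) = Q⁻¹ ∏_j e^{φ_j(k_j)}` on `X_{k,m}`. -/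
def nu {m : ℕ} (γ : Fin m → ℕ → ℝ≥0) (k : ℕ) (η : Fin m → ℕ) : ℝ :=
  (∏ j, (γ j (η j) : ℝ)) / partitionFn γ k

/-- The state space `X_{k,m} \ ν⁻¹{0}` of the chain. -/
abbrev State {m : ℕ} (γ : Fin m → ℕ → ℝ≥0) (k : ℕ) : Type :=
  {η : Fin m → ℕ // η ∈ (configs m k).filter (fun η => nu γ k η ≠ 0)}

/-- The configuration `η^{ij}`, in which a particle of `η` has moved from `i` to `j ≠ i`
(used only if there is a particle at `i`). -/
def move {m : ℕ} (η : Fin m → ℕ) (i j : Fin m) : Fin m → ℕ :=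
  Function.update (Function.update η i (η i - 1)) j (η j + 1)

/-- `ψ^{[δ]}(x - 1)`, with the convention `ψ^{[δ]}(-1) = +∞`. -/
def psiPred (δ : ℝ) (γ : ℕ → ℝ≥0) (x : ℕ) : EReal :=
  if x = 0 then ⊤ else psi δ γ (x - 1)

/-- The acceptance probability `exp{-[ψ_i^{[δ]}(k_i - 1) - ψ_j^{[δ]}(k_j)]⁺}`. The difference is
never of the form `∞ - ∞` at a configuration of positive `ν`-mass, since there
`ψ_i^{[δ]}(k_i - 1) > -∞` and `ψ_j^{[δ]}(k_j) < +∞`. -/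
def acceptance {m : ℕ} (δ : ℝ) (γ : Fin m → ℕ → ℝ≥0) (η : Fin m → ℕ) (i j : Fin m) : ℝ :=
  (EReal.exp (-max (psiPred δ (γ i) (η i) - psi δ (γ j) (η j)) 0)).toReal

/-- `l_δ = k^δ (k ∧ m)^{1-δ}`. -/
def ell (δ : ℝ) (k m : ℕ) : ℝ := (k : ℝ) ^ δ * (min (k : ℝ) (m : ℝ)) ^ (1 - δ)

/-- The probability `p(η, η^{ij})` for `i ≠ j`. -/
def jumpProb {m : ℕ} (δ : ℝ) (γ : Fin m → ℕ → ℝ≥0) (k : ℕ) (η : Fin m → ℕ) (i j : Fin m) : ℝ :=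
  (η i : ℝ) ^ δ / ell δ k m * (1 / (m : ℝ)) * acceptance δ γ η i j

/-- The transition matrix of the chain. For `η' ≠ η` at most one term of the sum is not zero. -/
def transition {m : ℕ} (δ : ℝ) (γ : Fin m → ℕ → ℝ≥0) (k : ℕ) :
    Matrix (State γ k) (State γ k) ℝ :=
  open Classical in
  fun η η' =>
    if η' = η then 1 - ∑ i, ∑ j, if i ≠ j then jumpProb δ γ k η.1 i j else 0
    else ∑ i, ∑ j, if i ≠ j ∧ η'.1 = move η.1 i j then jumpProb δ γ k η.1 i j else 0

/-- `P` is a probability (stochastic) matrix. -/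
def IsStochastic {S : Type} [Fintype S] (P : Matrix S S ℝ) : Prop :=
  (∀ x y, 0 ≤ P x y) ∧ ∀ x, ∑ y, P x y = 1

/-- Reversibility of `P` with respect to `π` (detailed balance). -/
def IsReversible {S : Type} (P : Matrix S S ℝ) (π : S → ℝ) : Prop :=
  ∀ x y, π x * P x y = π y * P y x

/-- Total variation distance of two probabilities on a finite set. -/
def tvDist {S : Type} [Fintype S] (a b : S → ℝ) : ℝ := (1 / 2) * ∑ x, |a x - b x|

/-- `d(t) = max_η ‖P^t(η, ·) - π‖_TV`. -/
def distToEq {S : Type} [Fintype S] [DecidableEq S] (P : Matrix S S ℝ) (π : S → ℝ) (t : ℕ) : ℝ :=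
  ⨆ x, tvDist ((P ^ t) x) π

/-- The mixing time `t_ε = inf {t ≥ 0 : d(t) ≤ ε}`. -/
def mixingTime {S : Type} [Fintype S] [DecidableEq S] (P : Matrix S S ℝ) (π : S → ℝ) (ε : ℝ) :
    ℕ :=
  sInf {t : ℕ | distToEq P π t ≤ ε}

/-- The restriction of `ν` to the state space. -/
def nuState {m : ℕ} (γ : Fin m → ℕ → ℝ≥0) (k : ℕ) (η : State γ k) : ℝ := nu γ k η.1

/-- The bound `((k ∧ m)^{1-δ} / δ) k m ln(k / ε)`. -/
def mixingBound (δ : ℝ) (k m : ℕ) (ε : ℝ) : ℝ :=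
  (min (k : ℝ) (m : ℝ)) ^ (1 - δ) / δ * k * m * Real.log (k / ε)

end LogConcaveChain

end

/-! Write κ for `rate`. One step of the chain turns a function varying by at most c between
neighbouring states (equal up to the position of one particle) into one varying by at most c(1 - κ):
this is path coupling in dual form, `nbrLip_stepOp`. Compare σ + unit a with σ + unit b. The
particles of σ receive the same proposals in both states. Since every ψ is non-increasing, the
acceptance probabilities are ordered, except for jumps whose one-sided acceptance still leaves
neighbours, so these proposals never increase the distance (`incr_sub_incr_le`). The odd particle is
sent to a common target, and in one of the two states its proposal to the site of the other is
accepted with probability 1, which merges them. Its weight is an increment of x^δ, at least δ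
k^(δ-1); divided by l_δ m this is κ.

As the supports are intervals, two states are joined by at most k neighbour moves inside the state
space. Hence d(t) ≤ k(1 - κ)^t ≤ k e^(-κt), which gives the bound for integers t ≥ B_ε.

To reach t_ε ≤ B_ε one more step must be gained: d(t) ≤ k e^(-κ(t+1)). Functions with values in
[0,1] have oscillation at most 1, far below what the Lipschitz bound allows at distance k. The
concave modulus a d - b d(d-1)/2 retains this: one step multiplies a by 1 - κ and b by 1 - 2κ
(`stepOp_sub_le_concaveCost`). Starting from a = 1, b = 1/(k-1), the value at d = k is k((1 - κ)^t -
(1 - 2κ)^t/2), and `pow_sub_half_pow_le_exp` concludes, since κ ≤ 1/4 for k, m ≥ 2. -/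

noncomputable section

namespace LogConcaveChain

/-! ### Acceptance probabilities in terms of real ratios -/

/-- The exponential `e^{ψ^{[δ]}(x)} = (x+1)^δ γ(x+1)/γ(x)` at a point of the support. -/
def upRatio (δ : ℝ) (γ : ℕ → ℝ≥0) (x : ℕ) : ℝ := γ (x + 1) * ((x : ℝ) + 1) ^ δ / γ x

/-- The exponential `e^{-ψ^{[δ]}(x-1)} = γ(x-1)/(x^δ γ(x))` at a point of the support. -/
def downRatio (δ : ℝ) (γ : ℕ → ℝ≥0) (x : ℕ) : ℝ := γ (x - 1) / (γ x * (x : ℝ) ^ δ)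

theorem phi_of_ne_zero {γ : ℕ → ℝ≥0} {x : ℕ} (h : γ x ≠ 0) :
    phi γ x = ((Real.log (γ x) : ℝ) : EReal) := by
  simp [phi, ENNReal.log, h]

theorem phi_of_eq_zero {γ : ℕ → ℝ≥0} {x : ℕ} (h : γ x = 0) : phi γ x = ⊥ := by
  simp [phi, h]

theorem psi_of_ne_zero_of_ne_zero {δ : ℝ} {γ : ℕ → ℝ≥0} {x : ℕ} (h : γ x ≠ 0)
    (h' : γ (x + 1) ≠ 0) :
    psi δ γ x = ((Real.log (upRatio δ γ x) : ℝ) : EReal) := by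
  have p1 : (0 : ℝ) < γ x := by positivity
  have p2 : (0 : ℝ) < γ (x + 1) := by positivity
  have p3 : (0 : ℝ) < (x : ℝ) + 1 := by positivity
  rw [psi, gradPhi, if_neg (by simp [h]), phi_of_ne_zero h, phi_of_ne_zero h', upRatio,
    Real.log_div (by positivity) (by positivity), Real.log_mul (by positivity) (by positivity),
    Real.log_rpow p3]
  norm_cast
  push_cast
  rw [add_comm (1 : ℝ)]
  ring

theorem psi_eq_bot {δ : ℝ} {γ : ℕ → ℝ≥0} {x : ℕ} (h : γ x ≠ 0) (h' : γ (x + 1) = 0) :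
    psi δ γ x = ⊥ := by
  rw [psi, gradPhi, if_neg (by simp [h]), phi_of_ne_zero h, phi_of_eq_zero h']
  simp

theorem psi_eq_top {δ : ℝ} {γ : ℕ → ℝ≥0} {x : ℕ} (h : γ x = 0) (h' : γ (x + 1) ≠ 0) :
    psi δ γ x = ⊤ := by
  rw [psi, gradPhi, if_neg (by simp [h']), phi_of_ne_zero h', phi_of_eq_zero h,
    EReal.coe_sub_bot, EReal.top_add_coe]

theorem upRatio_nonneg (δ : ℝ) (γ : ℕ → ℝ≥0) (x : ℕ) : 0 ≤ upRatio δ γ x := by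
  unfold upRatio; positivity

theorem downRatio_nonneg (δ : ℝ) (γ : ℕ → ℝ≥0) (x : ℕ) : 0 ≤ downRatio δ γ x := by
  unfold downRatio; positivity

/-- If γ vanishes at x or x + 1, both sides are 0 because 0⁻¹ = 0. At the bottom of the support this
is the right value, as ψ = +∞ just below it. -/
theorem downRatio_succ (δ : ℝ) (γ : ℕ → ℝ≥0) (x : ℕ) :
    downRatio δ γ (x + 1) = (upRatio δ γ x)⁻¹ := by
  simp [downRatio, upRatio]

theorem upRatio_pos {δ : ℝ} {γ : ℕ → ℝ≥0} {x : ℕ} (h : γ x ≠ 0) (h' : γ (x + 1) ≠ 0) :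
    0 < upRatio δ γ x := by
  unfold upRatio; positivity

variable {m : ℕ} {δ : ℝ} {γ : Fin m → ℕ → ℝ≥0} {k : ℕ}

theorem acceptance_nonneg (η : Fin m → ℕ) (i j : Fin m) : 0 ≤ acceptance δ γ η i j :=
  ENNReal.toReal_nonneg

theorem acceptance_le_one (η : Fin m → ℕ) (i j : Fin m) : acceptance δ γ η i j ≤ 1 := by
  refine ENNReal.toReal_le_of_le_ofReal zero_le_one ?_
  rw [ENNReal.ofReal_one, ← EReal.exp_zero]
  refine EReal.exp_monotone ?_
  rw [EReal.neg_le, neg_zero]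
  exact le_max_right _ _

/-- This removes the extended reals: on states the Metropolis factor is an ordinary minimum, and
infinite values of ψ become vanishing ratios. -/
theorem acceptance_eq {η : Fin m → ℕ} {i j : Fin m} (hi : γ i (η i) ≠ 0) (hj : γ j (η j) ≠ 0)
    (h0 : η i ≠ 0) :
    acceptance δ γ η i j = min 1 (upRatio δ (γ j) (η j) * downRatio δ (γ i) (η i)) := by
  obtain ⟨x, hx⟩ := Nat.exists_eq_succ_of_ne_zero h0
  have hpsi : psiPred δ (γ i) (η i) = psi δ (γ i) x := by
    rw [psiPred, if_neg h0, hx]; simp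
  rw [hx, Nat.succ_eq_add_one] at hi
  rw [acceptance, hpsi, hx, Nat.succ_eq_add_one, downRatio_succ]
  by_cases h1 : γ i x = 0
  · rw [psi_eq_top h1 hi]
    have hne : psi δ (γ j) (η j) ≠ ⊤ := by
      by_cases h2 : γ j (η j + 1) = 0
      · rw [psi_eq_bot hj h2]; simp
      · rw [psi_of_ne_zero_of_ne_zero hj h2]; simp
    have : (⊤ : EReal) - psi δ (γ j) (η j) = ⊤ := by
      rw [sub_eq_add_neg, EReal.top_add_of_ne_bot]
      simpa using hne
    rw [this]
    simp [upRatio, h1]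
  · rw [psi_of_ne_zero_of_ne_zero h1 hi]
    by_cases h2 : γ j (η j + 1) = 0
    · rw [psi_eq_bot hj h2]
      simp [upRatio, h2]
    · rw [psi_of_ne_zero_of_ne_zero hj h2]
      have hp := upRatio_pos (δ := δ) h1 hi
      have hq := upRatio_pos (δ := δ) hj h2
      have e : -max (((Real.log (upRatio δ (γ i) x) : ℝ) : EReal)
          - ((Real.log (upRatio δ (γ j) (η j)) : ℝ) : EReal)) 0
          = ((min (Real.log (upRatio δ (γ j) (η j)) - Real.log (upRatio δ (γ i) x)) 0 : ℝ) :
            EReal) := by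
        rw [← neg_sub (Real.log (upRatio δ (γ i) x)), ← EReal.coe_sub, ← EReal.coe_zero,
          ← EReal.coe_strictMono.monotone.map_max, ← EReal.coe_neg, max_def, min_def]
        congr 1
        split_ifs <;> linarith
      rw [e, EReal.exp_coe, ENNReal.toReal_ofReal (Real.exp_pos _).le,
        Real.exp_monotone.map_min, Real.exp_zero, min_comm, Real.exp_sub, Real.exp_log hp,
        Real.exp_log hq, div_eq_mul_inv]

theorem mul_rpow_le_of_antitone_psi {γ : ℕ → ℝ≥0} (h : LogConcave γ) (ha : Antitone (psi δ γ))
    (x : ℕ) :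
    (γ x * γ (x + 2) * ((x : ℝ) + 2) ^ δ : ℝ) ≤ γ (x + 1) ^ 2 * ((x : ℝ) + 1) ^ δ := by
  by_cases h0 : γ x = 0
  · simp only [h0]; simp; positivity
  by_cases h2 : γ (x + 2) = 0
  · simp only [h2]; simp; positivity
  have h1 : γ (x + 1) ≠ 0 := h.1.out h0 h2 ⟨by omega, by omega⟩
  have H := ha (Nat.le_succ x)
  rw [Nat.succ_eq_add_one, psi_of_ne_zero_of_ne_zero h0 h1, psi_of_ne_zero_of_ne_zero h1 h2,
    EReal.coe_le_coe_iff, Real.log_le_log_iff (upRatio_pos h1 h2) (upRatio_pos h0 h1),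
    upRatio, upRatio, div_le_div_iff₀ (by positivity) (by positivity)] at H
  push_cast at H
  rw [show (x : ℝ) + 1 + 1 = x + 2 by ring] at H
  calc _ = γ (x + 1 + 1) * ((x : ℝ) + 2) ^ δ * γ x := by ring
    _ ≤ _ := H
    _ = _ := by ring

theorem upRatio_succ_le {γ : ℕ → ℝ≥0} (h : LogConcave γ) (ha : Antitone (psi δ γ)) {x : ℕ}
    (h0 : γ x ≠ 0) (h1 : γ (x + 1) ≠ 0) : upRatio δ γ (x + 1) ≤ upRatio δ γ x := by
  rw [upRatio, upRatio, div_le_div_iff₀ (by positivity) (by positivity)]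
  have H := mul_rpow_le_of_antitone_psi h ha x
  push_cast
  rw [show (x : ℝ) + 1 + 1 = x + 2 by ring]
  calc _ = γ x * γ (x + 2) * ((x : ℝ) + 2) ^ δ := by ring
    _ ≤ _ := H
    _ = _ := by ring

theorem downRatio_le_succ {γ : ℕ → ℝ≥0} (h : LogConcave γ) (ha : Antitone (psi δ γ)) {x : ℕ}
    (hx : x ≠ 0) (h0 : γ x ≠ 0) (h1 : γ (x + 1) ≠ 0) :
    downRatio δ γ x ≤ downRatio δ γ (x + 1) := by
  obtain ⟨y, rfl⟩ := Nat.exists_eq_succ_of_ne_zero hx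
  rw [Nat.succ_eq_add_one] at *
  rw [downRatio_succ, downRatio_succ]
  by_cases hy : γ y = 0
  · rw [show upRatio δ γ y = 0 by simp [upRatio, hy], inv_zero]
    exact inv_nonneg.2 (upRatio_nonneg _ _ _)
  · exact inv_anti₀ (upRatio_pos h0 h1) (upRatio_succ_le h ha hy h0)

/-! ### States, single-particle moves and monotonicity of the acceptance -/

/-- The configurations of positive `ν`-mass. -/
def IsState (γ : Fin m → ℕ → ℝ≥0) (k : ℕ) (η : Fin m → ℕ) : Prop :=
  ∑ i, η i = k ∧ ∀ j, γ j (η j) ≠ 0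

/-- The hypotheses on the factors: log-concavity, with concavity at least `δ ∈ (0,1]`. -/
structure Regular (δ : ℝ) (γ : Fin m → ℕ → ℝ≥0) : Prop where
  logConcave : ∀ j, LogConcave (γ j)
  antitone : ∀ j, Antitone (psi δ (γ j))
  pos : 0 < δ
  le_one : δ ≤ 1

/-- A configuration with one particle, at `a`. -/
abbrev unit (a : Fin m) : Fin m → ℕ := Pi.single a 1

theorem add_unit_self (σ : Fin m → ℕ) (a : Fin m) : (σ + unit a) a = σ a + 1 := by simp

theorem add_unit_of_ne (σ : Fin m → ℕ) {a i : Fin m} (h : i ≠ a) : (σ + unit a) i = σ i := by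
  simp [h]

theorem move_add_unit (τ : Fin m → ℕ) {i j : Fin m} (h : i ≠ j) :
    move (τ + unit i) i j = τ + unit j := by
  funext l
  by_cases hj : l = j
  · subst hj; simp [move, h.symm]
  · by_cases hi : l = i
    · subst hi; simp [move, hj]
    · simp [move, hj, hi]

theorem exists_eq_add_unit {σ : Fin m → ℕ} {i : Fin m} (h : σ i ≠ 0) : ∃ τ, σ = τ + unit i := by
  refine ⟨σ - unit i, ?_⟩
  funext l
  by_cases hi : l = i
  · subst hi; simp; omega
  · simp [hi]

theorem sum_add_unit (σ : Fin m → ℕ) (a : Fin m) : ∑ i, (σ + unit a) i = ∑ i, σ i + 1 := by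
  simp [Finset.sum_add_distrib]

theorem isState_add_unit_left {σ : Fin m → ℕ} {a b : Fin m} (hab : a ≠ b)
    (hb : IsState γ k (σ + unit b)) : γ a (σ a) ≠ 0 := by
  have := hb.2 a
  rwa [add_unit_of_ne σ hab] at this

/-- Passing from σ + unit a to σ + unit b makes a more attractive as a target and b easier to leave.
The excluded cases i = a and j = b are those where the change goes the other way. -/
theorem acceptance_le_of_ne (H : Regular δ γ) {σ : Fin m → ℕ} {a b i j : Fin m} (hab : a ≠ b)
    (ha : IsState γ k (σ + unit a)) (hb : IsState γ k (σ + unit b)) (hi : i ≠ a) (hj : j ≠ b)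
    (h0 : σ i ≠ 0) :
    acceptance δ γ (σ + unit a) i j ≤ acceptance δ γ (σ + unit b) i j := by
  have hia : (σ + unit a) i = σ i := add_unit_of_ne σ hi
  have hjb : (σ + unit b) j = σ j := add_unit_of_ne σ hj
  rw [acceptance_eq (ha.2 i) (ha.2 j) (by rwa [hia]),
    acceptance_eq (hb.2 i) (hb.2 j) (by simp [h0])]
  refine min_le_min le_rfl (mul_le_mul ?_ ?_ (downRatio_nonneg _ _ _) (upRatio_nonneg _ _ _))
  · rw [hjb]
    by_cases h : j = a
    · subst h
      have h1 := ha.2 j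
      rw [add_unit_self] at h1 ⊢
      exact upRatio_succ_le (H.logConcave j) (H.antitone j) (isState_add_unit_left hab hb) h1
    · rw [add_unit_of_ne σ h]
  · rw [hia]
    by_cases h : i = b
    · subst h
      have h1 := hb.2 i
      rw [add_unit_self] at h1 ⊢
      exact downRatio_le_succ (H.logConcave i) (H.antitone i) h0
        (isState_add_unit_left hab.symm ha) h1
    · rw [add_unit_of_ne σ h]

theorem acceptance_add_unit_self {σ : Fin m → ℕ} {a b : Fin m} (hab : a ≠ b)
    (ha : IsState γ k (σ + unit a)) :
    acceptance δ γ (σ + unit a) a b =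
      min 1 (upRatio δ (γ b) (σ b) / upRatio δ (γ a) (σ a)) := by
  rw [acceptance_eq (ha.2 a) (ha.2 b) (by simp), add_unit_self, downRatio_succ,
    add_unit_of_ne σ hab.symm, div_eq_mul_inv]

/-- Moves out of the support have acceptance 0, so values of test functions off the states never
matter. -/
theorem isState_move {η : Fin m → ℕ} {i j : Fin m} (hη : IsState γ k η) (hij : i ≠ j)
    (h0 : η i ≠ 0) (h : acceptance δ γ η i j ≠ 0) : IsState γ k (move η i j) := by
  obtain ⟨τ, rfl⟩ := exists_eq_add_unit h0
  rw [move_add_unit τ hij]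
  refine ⟨by rw [sum_add_unit, ← hη.1, sum_add_unit], fun l => ?_⟩
  rw [acceptance_eq (hη.2 i) (hη.2 j) h0, add_unit_self, downRatio_succ,
    add_unit_of_ne τ hij.symm] at h
  have h1 : upRatio δ (γ j) (τ j) ≠ 0 := by
    intro h'; simp [h'] at h
  have h2 : upRatio δ (γ i) (τ i) ≠ 0 := by
    intro h'; simp [h'] at h
  by_cases hj : l = j
  · subst hj
    rw [add_unit_self]
    intro h'; simp [upRatio, h'] at h1
  · rw [add_unit_of_ne τ hj]
    by_cases hi : l = i
    · subst hi
      intro h'; simp [upRatio, h'] at h2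
    · have := hη.2 l
      rwa [add_unit_of_ne τ hi] at this

/-! ### Coupling estimates for a single proposed jump -/

/-- The function `g` varies by at most `c` between neighbouring states. -/
def NbrLip (γ : Fin m → ℕ → ℝ≥0) (k : ℕ) (c : ℝ) (g : (Fin m → ℕ) → ℝ) : Prop :=
  ∀ τ a b, IsState γ k (τ + unit a) → IsState γ k (τ + unit b) →
    g (τ + unit a) - g (τ + unit b) ≤ c

/-- The increment of `g` when a proposed jump from `i` to `j` is accepted or rejected. -/
def incr (δ : ℝ) (γ : Fin m → ℕ → ℝ≥0) (g : (Fin m → ℕ) → ℝ) (η : Fin m → ℕ) (i j : Fin m) : ℝ :=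
  if i ≠ j then acceptance δ γ η i j * (g (move η i j) - g η) else 0

/-- The transition operator of the chain, acting on functions on all configurations. -/
def stepOp (δ : ℝ) (γ : Fin m → ℕ → ℝ≥0) (k : ℕ) (g : (Fin m → ℕ) → ℝ) (η : Fin m → ℕ) : ℝ :=
  g η + (∑ i, (η i : ℝ) ^ δ * ∑ j, incr δ γ g η i j) / (ell δ k m * m)

theorem interp_sub_le_of_le {p q x x' y y' : ℝ} (hp : 0 ≤ p) (hpq : p ≤ q) (hq : q ≤ 1)
    (h1 : x - y ≤ 1) (h2 : 0 < p → x' - y' ≤ 1) (h3 : p < q → x - y' ≤ 1) :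
    x - y + p * (x' - x) - q * (y' - y) ≤ 1 := by
  have e1 : p * (x' - y') ≤ p := by
    rcases hp.eq_or_lt with rfl | h
    · simp
    · nlinarith [h2 h]
  have e2 : (q - p) * (x - y') ≤ q - p := by
    rcases hpq.eq_or_lt with rfl | h
    · simp
    · nlinarith [h3 h]
  have e3 : (1 - q) * (x - y) ≤ 1 - q := by nlinarith
  linarith

/-- Both proposals are accepted or rejected with one uniform variable: with probability min(p, q)
both move, with |p - q| only one does. The left side is the mean difference under this coupling. -/
theorem interp_sub_le {p q x x' y y' : ℝ} (hp : 0 ≤ p) (hp1 : p ≤ 1) (hq : 0 ≤ q) (hq1 : q ≤ 1)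
    (h1 : x - y ≤ 1) (h2 : 0 < p → 0 < q → x' - y' ≤ 1) (h3 : p < q → x - y' ≤ 1)
    (h4 : q < p → x' - y ≤ 1) :
    x - y + p * (x' - x) - q * (y' - y) ≤ 1 := by
  rcases le_total p q with h | h
  · exact interp_sub_le_of_le hp h hq1 h1 (fun h' => h2 h' (h'.trans_le h)) h3
  · have := interp_sub_le_of_le (x := -y) (x' := -y') (y := -x) (y' := -x') hq h hp1 (by linarith)
      (fun h' => by linarith [h2 (h'.trans_le h) h']) (fun h' => by linarith [h4 h'])
    linarith

theorem incr_sub_incr_le (H : Regular δ γ) {g : (Fin m → ℕ) → ℝ} (hg : NbrLip γ k 1 g)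
    {σ : Fin m → ℕ} {a b : Fin m} (hab : a ≠ b)
    (ha : IsState γ k (σ + unit a)) (hb : IsState γ k (σ + unit b)) {i : Fin m} (h0 : σ i ≠ 0)
    (j : Fin m) :
    g (σ + unit a) - g (σ + unit b) + incr δ γ g (σ + unit a) i j
      - incr δ γ g (σ + unit b) i j ≤ 1 := by
  by_cases hij : i = j
  · simpa [incr, hij] using hg σ a b ha hb
  have hia : (σ + unit a) i ≠ 0 := by simp [h0]
  have hib : (σ + unit b) i ≠ 0 := by simp [h0]
  have key1 := fun hi hj => acceptance_le_of_ne (δ := δ) (i := i) (j := j) H hab ha hb hi hj h0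
  have key2 := fun hi hj => acceptance_le_of_ne (δ := δ) (i := i) (j := j) H hab.symm hb ha hi hj h0
  have sa := fun h => isState_move (δ := δ) ha hij hia h
  have sb := fun h => isState_move (δ := δ) hb hij hib h
  obtain ⟨τ, rfl⟩ := exists_eq_add_unit h0
  have ea : move (τ + unit i + unit a) i j = τ + unit a + unit j := by
    rw [add_right_comm, move_add_unit _ hij]
  have eb : move (τ + unit i + unit b) i j = τ + unit b + unit j := by
    rw [add_right_comm, move_add_unit _ hij]
  simp only [incr, if_pos (show i ≠ j from hij)]
  rw [ea] at sa ⊢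
  rw [eb] at sb ⊢
  refine interp_sub_le (acceptance_nonneg _ _ _) (acceptance_le_one _ _ _)
    (acceptance_nonneg _ _ _) (acceptance_le_one _ _ _) (hg _ a b ha hb) ?_ ?_ ?_
  · intro hp hq
    have sa := sa hp.ne'
    have sb := sb hq.ne'
    rw [add_right_comm] at sa sb ⊢
    rw [add_right_comm τ (unit b)]
    exact hg _ a b sa sb
  · intro hpq
    have sb := sb ((acceptance_nonneg _ _ _).trans_lt hpq).ne'
    -- Here only the second state moves. Monotonicity would forbid p < q, so the jump fills a or
    -- leaves b, and the result is still a neighbour of σ + unit a.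
    have : j = a ∨ i = b := by
      by_contra! h
      exact absurd (key2 h.2 h.1) (not_le.2 hpq)
    rcases this with rfl | rfl
    · rw [add_right_comm] at sb ha
      rw [add_right_comm τ (unit b), add_right_comm τ (unit i)]
      exact hg _ i b ha sb
    · exact hg _ a j ha sb
  · intro hpq
    have sa := sa ((acceptance_nonneg _ _ _).trans_lt hpq).ne'
    have : j = b ∨ i = a := by
      by_contra! h
      exact absurd (key1 h.2 h.1) (not_le.2 hpq)
    rcases this with rfl | rfl
    · rw [add_right_comm] at sa hb
      rw [add_right_comm τ (unit a), add_right_comm τ (unit i)]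
      exact hg _ a i sa hb
    · exact hg _ j b sa hb

/-- A mean of two values minus a mean of two values, when the second points coincide. -/
theorem weighted_sub_le {P Q M x y z : ℝ} (hP : 0 ≤ P) (hQ : 0 ≤ Q) (hPM : P ≤ M) (hQM : Q ≤ M)
    (h1 : x - y ≤ 1) (h2 : 0 < P → z - y ≤ 1) (h3 : 0 < Q → x - z ≤ 1) :
    M * (x - y) + P * (z - x) - Q * (z - y) ≤ M := by
  rcases le_total P Q with h | h
  · have e1 : (M - Q) * (x - y) ≤ M - Q := by nlinarith
    have e2 : (Q - P) * (x - z) ≤ Q - P := by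
      rcases hQ.eq_or_lt with rfl | h'
      · have : P = 0 := le_antisymm h hP
        simp [this]
      · nlinarith [h3 h']
    linarith
  · have e1 : (M - P) * (x - y) ≤ M - P := by nlinarith
    have e2 : (P - Q) * (z - y) ≤ P - Q := by
      rcases hP.eq_or_lt with rfl | h'
      · have : Q = 0 := le_antisymm h hQ
        simp [this]
      · nlinarith [h2 h']
    linarith

/-- For the odd particle both accepted jumps lead to the same state σ + unit j. P and Q will be the
weights of this particle in the two states, M a common bound. -/
theorem incr_extra_le {g : (Fin m → ℕ) → ℝ} (hg : NbrLip γ k 1 g)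
    {σ : Fin m → ℕ} {a b : Fin m}
    (ha : IsState γ k (σ + unit a)) (hb : IsState γ k (σ + unit b)) (j : Fin m) {P Q M : ℝ}
    (hP : 0 ≤ P) (hQ : 0 ≤ Q) (hPM : P ≤ M) (hQM : Q ≤ M) :
    M * (g (σ + unit a) - g (σ + unit b)) + P * incr δ γ g (σ + unit a) a j
      - Q * incr δ γ g (σ + unit b) b j ≤ M := by
  have hst : ∀ c, IsState γ k (σ + unit c) → ∃ p, 0 ≤ p ∧ p ≤ 1 ∧
      incr δ γ g (σ + unit c) c j = p * (g (σ + unit j) - g (σ + unit c)) ∧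
      (0 < p → IsState γ k (σ + unit j)) := by
    intro c hc
    by_cases hcj : c = j
    · exact ⟨0, le_rfl, zero_le_one, by simp [incr, hcj], by simp⟩
    · refine ⟨acceptance δ γ (σ + unit c) c j, acceptance_nonneg _ _ _, acceptance_le_one _ _ _,
        ?_, fun h => ?_⟩
      · rw [incr, if_pos hcj, move_add_unit _ hcj]
      · have := isState_move hc hcj (by simp) h.ne'
        rwa [move_add_unit _ hcj] at this
  obtain ⟨p, hp, hp1, ep, sp⟩ := hst a ha
  obtain ⟨q, hq, hq1, eq, sq⟩ := hst b hb
  rw [ep, eq, ← mul_assoc, ← mul_assoc]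
  refine weighted_sub_le (by positivity) (by positivity) (by nlinarith) (by nlinarith)
    (hg _ a b ha hb) (fun h => hg _ _ _ (sp ?_) hb) (fun h => hg _ _ _ ha (sq ?_))
  · exact hp.lt_of_ne' fun h' => by simp [h'] at h
  · exact hq.lt_of_ne' fun h' => by simp [h'] at h

/-- The jump from a to b is accepted surely when the ratio at b is the larger one; it turns the
first state into the second. This saving of P is the only source of contraction. -/
theorem incr_extra_self_le {g : (Fin m → ℕ) → ℝ} (hg : NbrLip γ k 1 g)
    {σ : Fin m → ℕ} {a b : Fin m} (hab : a ≠ b)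
    (ha : IsState γ k (σ + unit a)) (hb : IsState γ k (σ + unit b))
    (hle : upRatio δ (γ a) (σ a) ≤ upRatio δ (γ b) (σ b)) {P Q M : ℝ} (hPM : P ≤ M) :
    M * (g (σ + unit a) - g (σ + unit b)) + P * incr δ γ g (σ + unit a) a b
      - Q * incr δ γ g (σ + unit b) b b ≤ M - P := by
  have hpos : 0 < upRatio δ (γ a) (σ a) := by
    have := ha.2 a
    rw [add_unit_self] at this
    exact upRatio_pos (isState_add_unit_left hab hb) this
  rw [incr, if_pos hab, acceptance_add_unit_self hab ha, move_add_unit _ hab, incr,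
    if_neg (by simp), min_eq_left ((one_le_div hpos).2 hle)]
  nlinarith [hg _ a b ha hb]

/-! ### Contraction of the Lipschitz constant -/

/-- The contraction rate of the chain. -/
def rate (δ : ℝ) (k m : ℕ) : ℝ := δ / ((min (k : ℝ) m) ^ (1 - δ) * k * m)

theorem ell_pos (hk : 0 < k) (hm : 0 < m) : 0 < ell δ k m := by
  have h1 : (0 : ℝ) < k := by exact_mod_cast hk
  have h2 : (0 : ℝ) < m := by exact_mod_cast hm
  have h3 : (0 : ℝ) < min (k : ℝ) m := lt_min h1 h2
  unfold ell
  positivity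

theorem rate_eq (hk : 0 < k) (hm : 0 < m) :
    rate δ k m = δ * (k : ℝ) ^ (δ - 1) / (ell δ k m * m) := by
  have h1 : (0 : ℝ) < k := by exact_mod_cast hk
  have h2 : (0 : ℝ) < m := by exact_mod_cast hm
  have h3 : (0 : ℝ) < min (k : ℝ) m := lt_min h1 h2
  rw [rate, ell, Real.rpow_sub_one h1.ne']
  field_simp

/-- With c occupied sites, concavity of x^δ (Jensen) bounds the sum by c (k/c)^δ = k^δ c^(1-δ), and
c ≤ k ∧ m. This makes l_δ a valid normalization. -/
theorem sum_rpow_le_ell (hδ0 : 0 < δ) (hδ1 : δ ≤ 1) (hm : 0 < m) (hk : 0 < k) {η : Fin m → ℕ}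
    (h : ∑ i, η i = k) : ∑ i, (η i : ℝ) ^ δ ≤ ell δ k m := by
  have h1 : (0 : ℝ) < k := by exact_mod_cast hk
  have h2 : (0 : ℝ) < m := by exact_mod_cast hm
  set s : Finset (Fin m) := Finset.univ.filter fun i => η i ≠ 0 with hs
  have hsum : ∑ i ∈ s, η i = k := by
    rw [← h, hs, Finset.sum_filter_ne_zero]
  have hsumR : ∑ i ∈ s, (η i : ℝ) = k := by exact_mod_cast hsum
  have hpow : ∑ i, (η i : ℝ) ^ δ = ∑ i ∈ s, (η i : ℝ) ^ δ := by
    refine (Finset.sum_subset (Finset.subset_univ s) fun i _ hi => ?_).symm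
    have : η i = 0 := by simpa [hs] using hi
    simp [this, hδ0.ne']
  have hcard : s.card ≤ k := by
    rw [← hsum, Finset.card_eq_sum_ones]
    refine Finset.sum_le_sum fun i hi => ?_
    have : η i ≠ 0 := by simpa [hs] using hi
    omega
  have hcard' : s.card ≤ m := by simpa using Finset.card_le_univ s
  have hc0 : 0 < s.card := by
    rw [Finset.card_pos]
    by_contra h'
    rw [Finset.not_nonempty_iff_eq_empty] at h'
    simp [h'] at hsum
    omega
  have hc : (0 : ℝ) < s.card := by exact_mod_cast hc0
  have hmin : (s.card : ℝ) ≤ min (k : ℝ) m :=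
    le_min (by exact_mod_cast hcard) (by exact_mod_cast hcard')
  have J := (Real.concaveOn_rpow hδ0.le hδ1).le_map_sum (t := s)
    (w := fun _ => (s.card : ℝ)⁻¹) (p := fun i => (η i : ℝ)) (fun i _ => by positivity)
    (by simp [hc.ne']) (fun i _ => by simp)
  simp only [smul_eq_mul, ← Finset.mul_sum, hsumR] at J
  rw [hpow]
  have J' : ∑ i ∈ s, (η i : ℝ) ^ δ ≤ s.card * ((s.card : ℝ)⁻¹ * k) ^ δ := by
    rwa [inv_mul_le_iff₀ hc] at J
  refine J'.trans ?_
  rw [Real.mul_rpow (by positivity) h1.le, Real.inv_rpow hc.le, ← mul_assoc,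
    ← Real.rpow_neg hc.le, mul_comm _ ((k : ℝ) ^ δ), ell]
  refine mul_le_mul_of_nonneg_left ?_ (by positivity)
  calc (s.card : ℝ) * (s.card : ℝ) ^ (-δ) = (s.card : ℝ) ^ (1 - δ) := by
        rw [sub_eq_add_neg, Real.rpow_add hc, Real.rpow_one]
    _ ≤ _ := Real.rpow_le_rpow hc.le hmin (by linarith)

/-- Bernoulli's inequality for the exponent δ bounds the increment below by δ (x+1)^(δ-1), which is
smallest at x + 1 = k. -/
theorem mul_rpow_sub_one_le (hδ0 : 0 < δ) (hδ1 : δ ≤ 1) {x : ℕ} (hx : x + 1 ≤ k) :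
    δ * (k : ℝ) ^ (δ - 1) ≤ ((x : ℝ) + 1) ^ δ - (x : ℝ) ^ δ := by
  have hx1 : (0 : ℝ) < (x : ℝ) + 1 := by positivity
  have hxk : (x : ℝ) + 1 ≤ k := by exact_mod_cast hx
  have h1 : (k : ℝ) ^ (δ - 1) ≤ ((x : ℝ) + 1) ^ (δ - 1) :=
    Real.rpow_le_rpow_of_nonpos hx1 hxk (by linarith)
  have h2 : ((x : ℝ) / (x + 1)) ^ δ ≤ 1 + δ * (-(1 / (x + 1))) := by
    have := rpow_one_add_le_one_add_mul_self (s := -(1 / ((x : ℝ) + 1))) (p := δ)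
      (by rw [neg_le_neg_iff, div_le_one hx1]; linarith [(Nat.cast_nonneg x : (0 : ℝ) ≤ x)])
      hδ0.le hδ1
    rwa [show 1 + -(1 / ((x : ℝ) + 1)) = x / (x + 1) by field_simp; ring] at this
  rw [Real.div_rpow (by positivity) hx1.le, div_le_iff₀ (by positivity)] at h2
  have h3 : ((x : ℝ) + 1) ^ (δ - 1) = ((x : ℝ) + 1) ^ δ * (1 / (x + 1)) := by
    rw [Real.rpow_sub_one hx1.ne']; ring
  have h4 := mul_le_mul_of_nonneg_left h1 hδ0.le
  rw [h3] at h4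
  linarith

theorem sum_rpow_mul_add_unit (σ : Fin m → ℕ) (a : Fin m) (F : Fin m → ℝ) :
    ∑ i, ((σ + unit a) i : ℝ) ^ δ * F i
      = ∑ i, (σ i : ℝ) ^ δ * F i + (((σ a : ℝ) + 1) ^ δ - (σ a : ℝ) ^ δ) * F a := by
  rw [← Finset.add_sum_erase _ _ (Finset.mem_univ a),
    ← Finset.add_sum_erase _ (fun i => (σ i : ℝ) ^ δ * F i) (Finset.mem_univ a),
    add_unit_self]
  rw [Finset.sum_congr rfl fun i hi => by rw [add_unit_of_ne σ (Finset.ne_of_mem_erase hi)]]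
  push_cast
  ring

/-- The total rate l_δ is split into the weight s of the common particles, the weight M allotted to
the odd particle, and an idle remainder l_δ - s - M. Only the odd particle's proposal to b brings a
gain. -/
theorem stepOp_sub_le_of_upRatio_le (H : Regular δ γ) (hk : 0 < k) (hm : 0 < m)
    {g : (Fin m → ℕ) → ℝ} (hg : NbrLip γ k 1 g)
    {σ : Fin m → ℕ} {a b : Fin m} (hab : a ≠ b)
    (ha : IsState γ k (σ + unit a)) (hb : IsState γ k (σ + unit b))
    (hle : upRatio δ (γ a) (σ a) ≤ upRatio δ (γ b) (σ b)) :
    stepOp δ γ k g (σ + unit a) - stepOp δ γ k g (σ + unit b) ≤ 1 - rate δ k m := by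
  have hL := ell_pos (δ := δ) hk hm
  have hmR : (0 : ℝ) < m := by exact_mod_cast hm
  set s : ℝ := ∑ i, (σ i : ℝ) ^ δ with hs
  have hΔ : ∀ c, IsState γ k (σ + unit c) →
      δ * (k : ℝ) ^ (δ - 1) ≤ ((σ c : ℝ) + 1) ^ δ - (σ c : ℝ) ^ δ ∧
      s + (((σ c : ℝ) + 1) ^ δ - (σ c : ℝ) ^ δ) ≤ ell δ k m := by
    intro c hc
    refine ⟨mul_rpow_sub_one_le H.pos H.le_one ?_, ?_⟩
    · rw [← hc.1, ← add_unit_self σ c]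
      exact Finset.single_le_sum (f := σ + unit c) (fun _ _ => Nat.zero_le _) (Finset.mem_univ c)
    · have := sum_rpow_le_ell H.pos H.le_one hm hk hc.1
      have e := sum_rpow_mul_add_unit (δ := δ) σ c fun _ => 1
      simp only [mul_one] at e
      rwa [e] at this
  obtain ⟨a1, a2⟩ := hΔ a ha
  obtain ⟨b1, b2⟩ := hΔ b hb
  set Da : ℝ := ((σ a : ℝ) + 1) ^ δ - (σ a : ℝ) ^ δ with hDa
  set Db : ℝ := ((σ b : ℝ) + 1) ^ δ - (σ b : ℝ) ^ δ with hDb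
  have hkpos : 0 ≤ δ * (k : ℝ) ^ (δ - 1) := mul_nonneg H.pos.le (by positivity)
  -- The odd particle may have different weights in the two states; the larger one is reserved, and
  -- s + M is still at most l_δ by the bound for the corresponding state.
  set M := max Da Db with hM
  have hsM : s + M ≤ ell δ k m := by
    rcases max_choice Da Db with h | h <;> rw [hM, h] <;> assumption
  set d : ℝ := g (σ + unit a) - g (σ + unit b) with hd
  have hd1 : d ≤ 1 := hg _ _ _ ha hb
  have base : ∑ i, (σ i : ℝ) ^ δ * ∑ j, (d + incr δ γ g (σ + unit a) i j
      - incr δ γ g (σ + unit b) i j) ≤ s * m := by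
    rw [hs, Finset.sum_mul]
    refine Finset.sum_le_sum fun i _ => ?_
    by_cases h0 : σ i = 0
    · simp [h0, H.pos.ne']
    · refine mul_le_mul_of_nonneg_left ?_ (by positivity)
      refine (Finset.sum_le_sum fun j _ => incr_sub_incr_le H hg hab ha hb h0 j).trans ?_
      simp
  have extra : ∑ j, (M * d + Da * incr δ γ g (σ + unit a) a j
      - Db * incr δ γ g (σ + unit b) b j) ≤ M * m - Da := by
    rw [← Finset.add_sum_erase _ _ (Finset.mem_univ b)]
    have e1 := incr_extra_self_le (δ := δ) hg hab ha hb hle (P := Da) (Q := Db) (M := M)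
      (le_max_left _ _)
    have e2 : ∑ j ∈ Finset.univ.erase b, (M * d + Da * incr δ γ g (σ + unit a) a j
      - Db * incr δ γ g (σ + unit b) b j) ≤ ∑ j ∈ Finset.univ.erase b, M :=
      Finset.sum_le_sum fun j _ => incr_extra_le hg ha hb j (hkpos.trans a1) (hkpos.trans b1)
        (le_max_left _ _) (le_max_right _ _)
    have e3 := Finset.add_sum_erase Finset.univ (fun _ => M) (Finset.mem_univ b)
    simp only [Finset.sum_const, Finset.card_univ, Fintype.card_fin, nsmul_eq_mul] at e2 e3
    linarith
  simp only [Finset.sum_sub_distrib, Finset.sum_add_distrib, ← Finset.mul_sum, mul_add, mul_sub,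
    Finset.sum_const, Finset.card_univ, Fintype.card_fin, nsmul_eq_mul] at base extra
  rw [← Finset.sum_mul, ← hs] at base
  rw [rate_eq hk hm, stepOp, stepOp, sum_rpow_mul_add_unit, sum_rpow_mul_add_unit, ← hDa, ← hDb]
  have hrest : (ell δ k m - s - M) * m * d ≤ (ell δ k m - s - M) * m :=
    mul_le_of_le_one_right (mul_nonneg (by linarith) hmR.le) hd1
  set Sa := ∑ i, (σ i : ℝ) ^ δ * ∑ j, incr δ γ g (σ + unit a) i j
  set Sb := ∑ i, (σ i : ℝ) ^ δ * ∑ j, incr δ γ g (σ + unit b) i j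
  set Ea := ∑ j, incr δ γ g (σ + unit a) a j
  set Eb := ∑ j, incr δ γ g (σ + unit b) b j
  have key : d + (Sa + Da * Ea - (Sb + Db * Eb)) / (ell δ k m * m)
      ≤ 1 - δ * (k : ℝ) ^ (δ - 1) / (ell δ k m * m) := by
    rw [← sub_nonneg]
    have : 1 - δ * (k : ℝ) ^ (δ - 1) / (ell δ k m * m)
        - (d + (Sa + Da * Ea - (Sb + Db * Eb)) / (ell δ k m * m))
        = (ell δ k m * m - δ * (k : ℝ) ^ (δ - 1) - d * (ell δ k m * m)
            - (Sa + Da * Ea - (Sb + Db * Eb))) / (ell δ k m * m) := by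
      field_simp
      ring
    rw [this]
    refine div_nonneg ?_ (by positivity)
    linarith
  calc _ = d + (Sa + Da * Ea - (Sb + Db * Eb)) / (ell δ k m * m) := by rw [hd]; ring
    _ ≤ _ := key

theorem incr_neg (g : (Fin m → ℕ) → ℝ) (η : Fin m → ℕ) (i j : Fin m) :
    incr δ γ (-g) η i j = -incr δ γ g η i j := by
  unfold incr
  split_ifs <;> simp
  ring

theorem stepOp_neg (g : (Fin m → ℕ) → ℝ) (η : Fin m → ℕ) :
    stepOp δ γ k (-g) η = -stepOp δ γ k g η := by
  simp only [stepOp, incr_neg, Finset.sum_neg_distrib, mul_neg, Pi.neg_apply]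
  ring

theorem stepOp_add (g h : (Fin m → ℕ) → ℝ) (η : Fin m → ℕ) :
    stepOp δ γ k (g + h) η = stepOp δ γ k g η + stepOp δ γ k h η := by
  have : ∀ i j, incr δ γ (g + h) η i j = incr δ γ g η i j + incr δ γ h η i j := by
    intro i j
    unfold incr
    split_ifs <;> simp
    ring
  simp only [stepOp, this, Finset.sum_add_distrib, mul_add, Pi.add_apply]
  ring

theorem stepOp_smul (c : ℝ) (g : (Fin m → ℕ) → ℝ) (η : Fin m → ℕ) :
    stepOp δ γ k (c • g) η = c * stepOp δ γ k g η := by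
  have : ∀ i j, incr δ γ (c • g) η i j = c * incr δ γ g η i j := by
    intro i j
    unfold incr
    split_ifs <;> simp
    ring
  simp only [stepOp, this, ← Finset.mul_sum, mul_left_comm _ c, Pi.smul_apply, smul_eq_mul]
  ring

theorem NbrLip.neg {c : ℝ} {g : (Fin m → ℕ) → ℝ} (hg : NbrLip γ k c g) : NbrLip γ k c (-g) :=
  fun τ a b ha hb => by simpa [add_comm, sub_eq_add_neg] using hg τ b a hb ha

theorem NbrLip.smul {c r : ℝ} (hr : 0 ≤ r) {g : (Fin m → ℕ) → ℝ} (hg : NbrLip γ k c g) :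
    NbrLip γ k (r * c) (r • g) :=
  fun τ a b ha hb => by
    simpa [mul_sub] using mul_le_mul_of_nonneg_left (hg τ a b ha hb) hr

theorem rate_nonneg (hδ : 0 < δ) : 0 ≤ rate δ k m :=
  div_nonneg hδ.le (by positivity)

theorem rate_le (hδ1 : δ ≤ 1) (hk : 0 < k) (hm : 0 < m) :
    rate δ k m ≤ 1 / (k * m) := by
  have h1 : (1 : ℝ) ≤ k := by exact_mod_cast hk
  have h2 : (1 : ℝ) ≤ m := by exact_mod_cast hm
  have h3 : (1 : ℝ) ≤ (min (k : ℝ) m) ^ (1 - δ) :=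
    Real.one_le_rpow (le_min h1 h2) (by linarith)
  unfold rate
  refine div_le_div₀ zero_le_one hδ1 (by positivity) ?_
  rw [mul_assoc]
  exact le_mul_of_one_le_left (by positivity) h3

theorem rate_pos (hδ : 0 < δ) (hk : 0 < k) (hm : 0 < m) : 0 < rate δ k m := by
  have h1 : (0 : ℝ) < k := by exact_mod_cast hk
  have h2 : (0 : ℝ) < m := by exact_mod_cast hm
  have h3 : (0 : ℝ) < min (k : ℝ) m := lt_min h1 h2
  unfold rate
  positivity

theorem rate_le_one (hδ1 : δ ≤ 1) (hk : 0 < k) (hm : 0 < m) :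
    rate δ k m ≤ 1 := by
  refine (rate_le hδ1 hk hm).trans ?_
  have h1 : (1 : ℝ) ≤ k := by exact_mod_cast hk
  have h2 : (1 : ℝ) ≤ m := by exact_mod_cast hm
  rw [div_le_one (by positivity)]
  nlinarith

/-- The chain contracts the distance of neighbouring states. -/
theorem nbrLip_stepOp_of_one (H : Regular δ γ) (hk : 0 < k) (hm : 0 < m)
    {g : (Fin m → ℕ) → ℝ} (hg : NbrLip γ k 1 g) : NbrLip γ k (1 - rate δ k m) (stepOp δ γ k g) := by
  intro σ a b ha hb
  by_cases hab : a = b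
  · subst hab
    simpa using rate_le_one H.le_one hk hm
  rcases le_total (upRatio δ (γ a) (σ a)) (upRatio δ (γ b) (σ b)) with h | h
  · exact stepOp_sub_le_of_upRatio_le H hk hm hg hab ha hb h
  · have := stepOp_sub_le_of_upRatio_le H hk hm hg.neg (Ne.symm hab) hb ha h
    rw [stepOp_neg, stepOp_neg] at this
    linarith

theorem nbrLip_stepOp (H : Regular δ γ) (hk : 0 < k) (hm : 0 < m) {c : ℝ} (hc : 0 ≤ c)
    {g : (Fin m → ℕ) → ℝ} (hg : NbrLip γ k c g) :
    NbrLip γ k (c * (1 - rate δ k m)) (stepOp δ γ k g) := by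
  rcases hc.eq_or_lt with rfl | hc
  · intro τ a b ha hb
    -- Rescaling by c⁻¹ is impossible for c = 0; instead g is treated as r-Lipschitz and r tends to
    -- 0.
    have h1 : ∀ r : ℝ, 0 < r → stepOp δ γ k g (τ + unit a) - stepOp δ γ k g (τ + unit b) ≤ r := by
      intro r hr
      have hg' : NbrLip γ k 1 (r⁻¹ • g) := by
        intro τ a b ha hb
        have := hg.smul (inv_nonneg.2 hr.le) τ a b ha hb
        linarith
      have := nbrLip_stepOp_of_one H hk hm hg' τ a b ha hb
      rw [stepOp_smul, stepOp_smul, ← mul_sub, inv_mul_le_iff₀ hr] at this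
      nlinarith [rate_nonneg (k := k) (m := m) H.pos]
    rw [zero_mul]
    exact le_of_forall_pos_le_add fun r hr => by linarith [h1 r hr]
  · have hg' : NbrLip γ k 1 (c⁻¹ • g) := by
      have := hg.smul (inv_nonneg.2 hc.le)
      rwa [inv_mul_cancel₀ hc.ne'] at this
    intro τ a b ha hb
    have := nbrLip_stepOp_of_one H hk hm hg' τ a b ha hb
    rwa [stepOp_smul, stepOp_smul, ← mul_sub, inv_mul_le_iff₀ hc] at this

/-! ### The numerical inequality behind the gain of one step -/

theorem le_neg_log_one_sub {x : ℝ} (h0 : 0 ≤ x) (h1 : x < 1) (n : ℕ) :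
    ∑ i ∈ Finset.range n, x ^ (i + 1) / (i + 1) ≤ -Real.log (1 - x) := by
  have h := Real.hasSum_pow_div_log_of_abs_lt_one (x := x) (by rwa [abs_of_nonneg h0])
  exact sum_le_hasSum _ (fun i _ => by positivity) h

theorem log_six_ge : (1.7906 : ℝ) ≤ Real.log 6 := by
  -- 6^12 = 2176782336 only just exceeds 2^31 = 2147483648.
  have h : Real.log ((2 : ℝ) ^ 31) ≤ Real.log ((6 : ℝ) ^ 12) :=
    Real.log_le_log (by norm_num) (by norm_num)
  rw [Real.log_pow, Real.log_pow] at h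
  have := Real.log_two_gt_d9
  push_cast at h
  linarith

theorem mul_tangent_le_exp {c : ℝ} (hc : 0 < c) (u : ℝ) :
    c * (1 + u - Real.log c) ≤ Real.exp u := by
  have h := Real.add_one_le_exp (u - Real.log c)
  rw [Real.exp_sub, Real.exp_log hc, le_div_iff₀ hc] at h
  linarith

/-- The series begins x + 3x²/2 + 7x³/3; the coefficient 4 absorbs the tail for x ≤ 1/4. The proof
compares with the Taylor polynomial of exp of degree 4, leaving x³ times a factor that is positive
on this range. -/
theorem log_one_sub_div_le {x : ℝ} (h0 : 0 < x) (h1 : x ≤ 1 / 4) :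
    Real.log ((1 - x) / (1 - 2 * x)) ≤ x + 3 / 2 * x ^ 2 + 4 * x ^ 3 := by
  have hp : 0 < 1 - 2 * x := by linarith
  rw [Real.log_le_iff_le_exp (div_pos (by linarith) hp), div_le_iff₀ hp]
  set r := x + 3 / 2 * x ^ 2 + 4 * x ^ 3 with hr
  have hr0 : 0 ≤ r := by positivity
  have he := Real.sum_le_exp_of_nonneg hr0 5
  simp only [Finset.sum_range_succ, Finset.sum_range_zero, Nat.factorial] at he
  norm_num at he
  refine le_trans ?_ (mul_le_mul_of_nonneg_right he hp.le)
  have hpow : ∀ i : ℕ, x ^ i ≤ (1 / 4) ^ i := fun i => pow_le_pow_left₀ h0.le h1 i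
  have hq : 0 ≤ x ^ 3 * (5/3 - 65/12 * x - 59/24 * x ^ 2 - 71/24 * x ^ 3 - 745/48 * x ^ 4
      - 1461/128 * x ^ 5 - 3169/192 * x ^ 6 - 181/6 * x ^ 7 - 70/3 * x ^ 8
      - 64/3 * x ^ 9 - 64/3 * x ^ 10) := by
    refine mul_nonneg (by positivity) ?_
    linarith [hpow 2, hpow 3, hpow 4, hpow 5, hpow 6, hpow 7, hpow 8, hpow 9, hpow 10]
  rw [hr]
  linarith

/-- Dividing by (1 - x)^n = e^(-sn) reduces the claim to 1 ≤ e^((s-x)n - x) + e^(-rn)/2. Tangents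
bound the two terms below by affine functions of n with weights 1 - w and w; it remains that the
total slope and the total constant are non-negative. -/
theorem pow_sub_half_pow_le_exp {x : ℝ} (h0 : 0 < x) (h1 : x ≤ 1 / 4) (n : ℕ) :
    (1 - x) ^ n - 1 / 2 * (1 - 2 * x) ^ n ≤ Real.exp (-x * (n + 1)) := by
  have p1 : 0 < 1 - x := by linarith
  have p2 : 0 < 1 - 2 * x := by linarith
  set s := -Real.log (1 - x) with hs
  set r := Real.log ((1 - x) / (1 - 2 * x)) with hr
  have hsA : x + x ^ 2 / 2 + x ^ 3 / 3 + x ^ 4 / 4 ≤ s := by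
    have := le_neg_log_one_sub h0.le (by linarith : x < 1) 4
    simp only [Finset.sum_range_succ, Finset.sum_range_zero] at this
    norm_num at this
    linarith
  have hrR : r ≤ x + 3 / 2 * x ^ 2 + 4 * x ^ 3 := log_one_sub_div_le h0 h1
  have e1 : (1 - x) ^ n = Real.exp (-s * n) := by
    rw [hs, neg_neg, mul_comm, Real.exp_nat_mul, Real.exp_log p1]
  have e2 : (1 - 2 * x) ^ n = Real.exp (-s * n) * Real.exp (-r * n) := by
    rw [← Real.exp_add, hs, hr, Real.log_div p1.ne' p2.ne',
      show -(-Real.log (1 - x)) * (n : ℝ) + -(Real.log (1 - x) - Real.log (1 - 2 * x)) * n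
        = n * Real.log (1 - 2 * x) by ring, Real.exp_nat_mul, Real.exp_log p2]
  have e3 : Real.exp (-x * (n + 1)) = Real.exp (-s * n) * Real.exp ((s - x) * n - x) := by
    rw [← Real.exp_add]; congr 1; ring
  suffices 1 ≤ Real.exp ((s - x) * n - x) + 1 / 2 * Real.exp (-r * n) by
    rw [e1, e2, e3]
    nlinarith [Real.exp_pos (-s * n)]
  have hden : 0 < 2 + 3.9 * x := by linarith
  -- To leading order s - x is x²/2 and r is x, so the slope vanishes for w near x/2. The correction
  -- 3.9 x keeps both the slope and the constant non-negative up to x = 1/4.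
  set w := x / (2 + 3.9 * x) with hw
  have hw0 : 0 < w := div_pos h0 hden
  have hwx : w * (2 + 3.9 * x) = x := div_mul_cancel₀ _ hden.ne'
  have hw2 : w ≤ 0.0841 := by
    rw [hw, div_le_iff₀ hden]; linarith
  have t1 := mul_tangent_le_exp (by linarith : 0 < 1 - w) ((s - x) * n - x)
  have t2 := mul_tangent_le_exp (by linarith : 0 < 2 * w) (-r * n)
  have l1 : w + w ^ 2 / 2 ≤ -Real.log (1 - w) := by
    have := le_neg_log_one_sub hw0.le (by linarith : w < 1) 2
    simp only [Finset.sum_range_succ, Finset.sum_range_zero] at this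
    norm_num at this
    linarith
  -- Tangent of the logarithm at w = 1/12, close to the largest admissible w, where the constant
  -- term is tightest.
  have l2 : 2.7906 - 12 * w ≤ -Real.log (2 * w) := by
    have h := Real.log_le_sub_one_of_pos (by linarith : 0 < 6 * (2 * w))
    rw [Real.log_mul (by norm_num) (by linarith)] at h
    linarith [log_six_ge]
  have hslope : 0 ≤ (1 - w) * (s - x) - w * r := by
    have hd : 0 ≤ (2 + 2.9 * x) * (x ^ 2 / 2 + x ^ 3 / 3 + x ^ 4 / 4)
        - x * (x + 3 / 2 * x ^ 2 + 4 * x ^ 3) := by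
      have : (2 + 2.9 * x) * (x ^ 2 / 2 + x ^ 3 / 3 + x ^ 4 / 4)
        - x * (x + 3 / 2 * x ^ 2 + 4 * x ^ 3)
        = x ^ 3 * ((2 / 3 + 2.9 / 2 - 3 / 2) + (1 / 2 + 2.9 / 3 - 4) * x + 2.9 / 4 * x ^ 2) := by
        ring
      rw [this]
      refine mul_nonneg (by positivity) ?_
      nlinarith [sq_nonneg (x - 1 / 4)]
    have h3 : 0 ≤ (2 + 3.9 * x) * ((1 - w) * (s - x) - w * r) := by
      have : (2 + 3.9 * x) * ((1 - w) * (s - x) - w * r)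
          = (2 + 2.9 * x) * (s - x) - x * r := by
        linear_combination (-(s - x) - r) * hwx
      rw [this]
      nlinarith
    exact (mul_nonneg_iff_of_pos_left hden).1 h3
  have hconst : 0 ≤ (1 - w) * (-x + w + w ^ 2 / 2) + w * (2.7906 - 12 * w) := by
    have hx : x * (1 - 3.9 * w) = 2 * w := by linear_combination -hwx
    have hq : 0 < 1 - 3.9 * w := by linarith
    have h3 : 0 ≤ (1 - 3.9 * w) *
        ((1 - w) * (-x + w + w ^ 2 / 2) + w * (2.7906 - 12 * w)) := by
      have : (1 - 3.9 * w) * ((1 - w) * (-x + w + w ^ 2 / 2) + w * (2.7906 - 12 * w))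
          = w * ((1 - w) * (-2 + (1 - 3.9 * w) * (1 + w / 2))
            + (1 - 3.9 * w) * (2.7906 - 12 * w)) := by
        linear_combination (-(1 - w)) * hx
      rw [this]
      refine mul_nonneg hw0.le ?_
      nlinarith [mul_nonneg hw0.le (sub_nonneg.2 hw2), pow_pos hw0 3,
        mul_nonneg (sq_nonneg w) (sub_nonneg.2 hw2)]
    exact (mul_nonneg_iff_of_pos_left hq).1 h3
  have m1 : (1 - w) * (w + w ^ 2 / 2) ≤ (1 - w) * -Real.log (1 - w) :=
    mul_le_mul_of_nonneg_left l1 (by linarith)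
  have m2 : w * (2.7906 - 12 * w) ≤ w * -Real.log (2 * w) :=
    mul_le_mul_of_nonneg_left l2 hw0.le
  have m3 : 0 ≤ ((1 - w) * (s - x) - w * r) * n := mul_nonneg hslope (Nat.cast_nonneg n)
  linarith

/-! ### Distance of configurations and the concave modulus -/

/-- The number of particles to be moved to transform `x` into `y`. -/
def moveDist (x y : Fin m → ℕ) : ℕ := ∑ i, (x i - y i)

theorem moveDist_self (x : Fin m → ℕ) : moveDist x x = 0 := by simp [moveDist]

theorem moveDist_triangle (x y z : Fin m → ℕ) : moveDist x z ≤ moveDist x y + moveDist y z := by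
  rw [moveDist, moveDist, moveDist, ← Finset.sum_add_distrib]
  exact Finset.sum_le_sum fun i _ => by omega

theorem moveDist_le {x : Fin m → ℕ} (hx : IsState γ k x) (y : Fin m → ℕ) : moveDist x y ≤ k := by
  rw [← hx.1]
  exact Finset.sum_le_sum fun i _ => by omega

theorem moveDist_add_unit_le (τ : Fin m → ℕ) (a b : Fin m) :
    moveDist (τ + unit a) (τ + unit b) ≤ 1 := by
  calc moveDist (τ + unit a) (τ + unit b) ≤ ∑ i, unit a i :=
        Finset.sum_le_sum fun i _ => by simp only [Pi.add_apply]; omega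
    _ = 1 := by simp

theorem exists_lt_of_ne {x y : Fin m → ℕ} (h : ∑ i, x i = ∑ i, y i) (hne : x ≠ y) :
    ∃ i, y i < x i := by
  by_contra! hle
  exact hne (funext fun i => (Finset.sum_eq_sum_iff_of_le fun i _ => hle i).1 h i
    (Finset.mem_univ i))

/-- A particle moves from a site with excess to one with deficit. Both new occupation numbers lie
between those of x and y, so interval supports keep the path among the states. -/
theorem exists_nbr (hγ : ∀ j, LogConcave (γ j)) {x y : Fin m → ℕ} (hx : IsState γ k x)
    (hy : IsState γ k y) (hne : x ≠ y) :
    ∃ τ i j, x = τ + unit i ∧ IsState γ k (τ + unit j) ∧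
      moveDist (τ + unit j) y + 1 = moveDist x y := by
  obtain ⟨i, hi⟩ := exists_lt_of_ne (hx.1.trans hy.1.symm) hne
  obtain ⟨j, hj⟩ := exists_lt_of_ne (hy.1.trans hx.1.symm) hne.symm
  obtain ⟨τ, rfl⟩ := exists_eq_add_unit (σ := x) (i := i) (by omega)
  have hij : j ≠ i := by rintro rfl; omega
  rw [add_unit_self] at hi
  rw [add_unit_of_ne τ hij] at hj
  refine ⟨τ, i, j, rfl, ⟨by rw [sum_add_unit, ← hx.1, sum_add_unit], fun l => ?_⟩, ?_⟩
  · by_cases hl : l = j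
    · subst hl
      rw [add_unit_self]
      refine (hγ l).1.out (x := τ l) (y := y l) ?_ (hy.2 l) ⟨by omega, by omega⟩
      have := hx.2 l
      rwa [add_unit_of_ne τ hij] at this
    · rw [add_unit_of_ne τ hl]
      by_cases hl' : l = i
      · subst hl'
        refine (hγ l).1.out (x := y l) (y := τ l + 1) (hy.2 l) ?_ ⟨by omega, by omega⟩
        have := hx.2 l
        rwa [add_unit_self] at this
      · have := hx.2 l
        rwa [add_unit_of_ne τ hl'] at this
  · have e1 : moveDist (τ + unit j) y = ∑ l, (τ l - y l) := by
      refine Finset.sum_congr rfl fun l _ => ?_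
      by_cases hl : l = j
      · subst hl; rw [add_unit_self]; omega
      · rw [add_unit_of_ne τ hl]
    have e2 : moveDist (τ + unit i) y = ∑ l, ((τ l - y l) + unit i l) := by
      refine Finset.sum_congr rfl fun l _ => ?_
      by_cases hl : l = i
      · subst hl; rw [add_unit_self]; simp; omega
      · rw [add_unit_of_ne τ hl]; simp [hl]
    rw [e1, e2, Finset.sum_add_distrib]
    simp

theorem NbrLip.sub_le (hγ : ∀ j, LogConcave (γ j)) {c : ℝ} {g : (Fin m → ℕ) → ℝ}
    (hg : NbrLip γ k c g) {x y : Fin m → ℕ} (hx : IsState γ k x) (hy : IsState γ k y) :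
    g x - g y ≤ c * moveDist x y := by
  induction hd : moveDist x y generalizing x with
  | zero =>
    by_cases hne : x = y
    · simp [hne]
    · obtain ⟨τ, i, j, -, -, h⟩ := exists_nbr hγ hx hy hne
      omega
  | succ d ih =>
    have hne : x ≠ y := by
      rintro rfl
      simp [moveDist_self] at hd
    obtain ⟨τ, i, j, rfl, hj, h⟩ := exists_nbr hγ hx hy hne
    have h1 := ih hj (by omega)
    have h2 := hg τ i j hx hj
    push_cast
    linarith

theorem finite_isState (γ : Fin m → ℕ → ℝ≥0) (k : ℕ) : {x | IsState γ k x}.Finite :=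
  (configs m k).finite_toSet.subset fun x hx => by simp [configs, hx.1]

theorem stepOp_le (hk : 0 < k) (hm : 0 < m) (hδ0 : 0 < δ) (hδ1 : δ ≤ 1) {g : (Fin m → ℕ) → ℝ}
    {c : ℝ} (hg : ∀ x, IsState γ k x → g x ≤ c) {x : Fin m → ℕ} (hx : IsState γ k x) :
    stepOp δ γ k g x ≤ c := by
  have hL := ell_pos (δ := δ) hk hm
  have hmR : (0 : ℝ) < m := by exact_mod_cast hm
  have hs := sum_rpow_le_ell hδ0 hδ1 hm hk hx.1
  have h1 : ∑ i, (x i : ℝ) ^ δ * ∑ j, incr δ γ g x i j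
      ≤ ∑ i, (x i : ℝ) ^ δ * (m * (c - g x)) := by
    refine Finset.sum_le_sum fun i _ => ?_
    by_cases h0 : x i = 0
    · simp [h0, hδ0.ne']
    refine mul_le_mul_of_nonneg_left ?_ (by positivity)
    have : ∀ j ∈ Finset.univ, incr δ γ g x i j ≤ c - g x := by
      intro j _
      have hc := hg x hx
      unfold incr
      split_ifs with hij
      · have ha := acceptance_nonneg (δ := δ) (γ := γ) x i j
        have ha1 := acceptance_le_one (δ := δ) (γ := γ) x i j
        rcases ha.eq_or_lt with h | h
        · rw [← h]; linarith
        · have := hg _ (isState_move hx hij h0 h.ne')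
          nlinarith
      · linarith
    refine (Finset.sum_le_sum this).trans_eq ?_
    rw [Finset.sum_const, Finset.card_univ, Fintype.card_fin, nsmul_eq_mul]
  rw [← Finset.sum_mul] at h1
  have h2 : (∑ i, (x i : ℝ) ^ δ) * (m * (c - g x)) ≤ ell δ k m * (m * (c - g x)) :=
    mul_le_mul_of_nonneg_right hs (mul_nonneg hmR.le (by linarith [hg x hx]))
  have h3 : (∑ i, (x i : ℝ) ^ δ * ∑ j, incr δ γ g x i j) / (ell δ k m * m) ≤ c - g x := by
    rw [div_le_iff₀ (by positivity)]
    linarith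
  rw [stepOp]
  linarith

theorem le_stepOp (hk : 0 < k) (hm : 0 < m) (hδ0 : 0 < δ) (hδ1 : δ ≤ 1) {g : (Fin m → ℕ) → ℝ}
    {c : ℝ} (hg : ∀ x, IsState γ k x → c ≤ g x) {x : Fin m → ℕ} (hx : IsState γ k x) :
    c ≤ stepOp δ γ k g x := by
  have := stepOp_le (g := -g) (c := -c) hk hm hδ0 hδ1 (fun y hy => neg_le_neg (hg y hy)) hx
  rw [stepOp_neg] at this
  linarith

/-- The concave function `d ↦ a d - b d(d-1)/2`. -/
def concaveCost (a b : ℝ) (d : ℕ) : ℝ := a * d - b * (d * (d - 1) / 2)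

/-- The difference of the two sides is b (d - e)(d - e - 1)/2, non-negative because d and e are
integers. The line is the chord through d - 1 and d. -/
theorem concaveCost_le_tangent {b : ℝ} (a : ℝ) (hb : 0 ≤ b) (d e : ℕ) :
    concaveCost a b e ≤ (a - b * (d - 1)) * e + b * (d * (d - 1) / 2) := by
  have h : (0 : ℝ) ≤ ((d : ℝ) - e) * (d - e - 1) := by
    rcases le_or_gt d e with h | h
    · have : (d : ℝ) ≤ e := by exact_mod_cast h
      nlinarith
    · have : (e : ℝ) + 1 ≤ d := by exact_mod_cast h
      exact mul_nonneg (by linarith) (by linarith)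
  unfold concaveCost
  nlinarith [mul_nonneg hb h]

/-- A function with a concave modulus of continuity is the sum of a Lipschitz function and a
bounded one. -/
theorem exists_nbrLip_approx {g : (Fin m → ℕ) → ℝ} {s c : ℝ} (hs : 0 ≤ s)
    (hg : ∀ x y, IsState γ k x → IsState γ k y → g x - g y ≤ s * moveDist x y + c) :
    ∃ h : (Fin m → ℕ) → ℝ, NbrLip γ k s h ∧
      ∀ x, IsState γ k x → 0 ≤ g x - h x ∧ g x - h x ≤ c := by
  by_cases hne : {x | IsState γ k x}.Nonempty
  · have hmin : ∀ x, ∃ y, IsState γ k y ∧ ∀ z, IsState γ k z →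
        g y + s * moveDist x y ≤ g z + s * moveDist x z := by
      intro x
      obtain ⟨y, hy, h⟩ := Set.exists_min_image {x | IsState γ k x}
        (fun y => g y + s * moveDist x y) (finite_isState γ k) hne
      exact ⟨y, hy, fun z hz => h z hz⟩
    choose f hf hfm using hmin
    -- The Lipschitz part is the infimal convolution of g with s times the distance.
    refine ⟨fun x => g (f x) + s * moveDist x (f x), fun τ a b _ _ => ?_, fun x hx => ⟨?_, ?_⟩⟩
    · have h1 := hfm (τ + unit a) (f (τ + unit b)) (hf _)
      have h2 := moveDist_triangle (τ + unit a) (τ + unit b) (f (τ + unit b))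
      have h3 : (moveDist (τ + unit a) (f (τ + unit b)) : ℝ)
          ≤ 1 + moveDist (τ + unit b) (f (τ + unit b)) := by
        exact_mod_cast h2.trans (Nat.add_le_add_right (moveDist_add_unit_le τ a b) _)
      nlinarith [mul_le_mul_of_nonneg_left h3 hs]
    · have := hfm x x hx
      rw [moveDist_self] at this
      simp only [Nat.cast_zero, mul_zero, add_zero] at this
      linarith
    · have := hg x (f x) hx (hf x)
      linarith
  · exact ⟨0, fun τ a b ha _ => absurd ⟨_, ha⟩ hne, fun x hx => absurd ⟨_, hx⟩ hne⟩

/-- One step of the chain improves a concave modulus of continuity. -/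
theorem stepOp_sub_le_concaveCost (H : Regular δ γ) (hk : 0 < k) (hm : 0 < m) {a b : ℝ}
    (hb : 0 ≤ b) (hab : b * (k - 1) ≤ a) {g : (Fin m → ℕ) → ℝ}
    (hg : ∀ x y, IsState γ k x → IsState γ k y → g x - g y ≤ concaveCost a b (moveDist x y))
    {x y : Fin m → ℕ} (hx : IsState γ k x) (hy : IsState γ k y) :
    stepOp δ γ k g x - stepOp δ γ k g y
      ≤ concaveCost (a * (1 - rate δ k m)) (b * (1 - 2 * rate δ k m)) (moveDist x y) := by
  set d := moveDist x y with hd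
  have hdk : (d : ℝ) ≤ k := by exact_mod_cast moveDist_le hx y
  have hs : 0 ≤ a - b * ((d : ℝ) - 1) := by nlinarith
  obtain ⟨h, hh, hgh⟩ := exists_nbrLip_approx (γ := γ) (k := k) (g := g) hs
    (c := b * (d * (d - 1) / 2))
    fun x y hx hy => (hg x y hx hy).trans (concaveCost_le_tangent a hb d _)
  have h1 := (nbrLip_stepOp H hk hm hs hh).sub_le H.logConcave hx hy
  have h2 := stepOp_le (g := g + -h) hk hm H.pos H.le_one
   
    (fun z hz => (sub_eq_add_neg _ _).symm.trans_le (hgh z hz).2) hx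
  have h3 := le_stepOp (g := g + -h) hk hm H.pos H.le_one
    (c := 0)
    (fun z hz => (hgh z hz).1.trans_eq (sub_eq_add_neg _ _)) hy
  rw [stepOp_add, stepOp_neg] at h2 h3
  rw [← hd] at h1
  -- The Lipschitz part contracts by 1 - κ while the bounded part only stays within [0, c]. Together
  -- they give (a - b(d-1))(1-κ)d + b d(d-1)/2, in which b d(d-1)/2 has coefficient -(1 - 2κ).
  unfold concaveCost
  linarith

/-- The `t`-step transition operator is a contraction for the distance of configurations. -/
theorem nbrLip_iterate (H : Regular δ γ) (hk : 0 < k) (hm : 0 < m) {g : (Fin m → ℕ) → ℝ}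
    (hg : NbrLip γ k 1 g) (t : ℕ) :
    NbrLip γ k ((1 - rate δ k m) ^ t) ((stepOp δ γ k)^[t] g) := by
  induction t with
  | zero => simpa using hg
  | succ t ih =>
    rw [Function.iterate_succ_apply', pow_succ]
    exact nbrLip_stepOp H hk hm
      (pow_nonneg (sub_nonneg.2 (rate_le_one H.le_one hk hm)) t) ih

theorem iterate_sub_le_concaveCost (H : Regular δ γ) (hk : 2 ≤ k) (hm : 2 ≤ m)
    {g : (Fin m → ℕ) → ℝ} (hg : ∀ x y, IsState γ k x → IsState γ k y → g x - g y ≤ 1) (t : ℕ)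
    {x y : Fin m → ℕ} (hx : IsState γ k x) (hy : IsState γ k y) :
    (stepOp δ γ k)^[t] g x - (stepOp δ γ k)^[t] g y
      ≤ concaveCost ((1 - rate δ k m) ^ t) (1 / (k - 1) * (1 - 2 * rate δ k m) ^ t)
        (moveDist x y) := by
  have hk0 : 0 < k := by omega
  have hm0 : 0 < m := by omega
  have hkR : (2 : ℝ) ≤ k := by exact_mod_cast hk
  have hmR : (2 : ℝ) ≤ m := by exact_mod_cast hm
  have hk1 : (0 : ℝ) < k - 1 := by linarith
  have hr0 := rate_nonneg (k := k) (m := m) H.pos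
  have hr : rate δ k m ≤ 1 / 4 :=
    (rate_le H.le_one hk0 hm0).trans (one_div_le_one_div_of_le (by norm_num) (by nlinarith))
  induction t generalizing x y with
  | zero =>
    rcases Nat.eq_zero_or_pos (moveDist x y) with h | h
    · have hxy : x = y := by
        by_contra hne
        obtain ⟨_, _, _, _, _, h'⟩ := exists_nbr H.logConcave hx hy hne
        omega
      simp [concaveCost, hxy, moveDist_self]
    · refine (hg x y hx hy).trans ?_
      have h1 : (1 : ℝ) ≤ moveDist x y := by exact_mod_cast h
      have h2 : (moveDist x y : ℝ) ≤ k := by exact_mod_cast moveDist_le hx y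
      set d : ℝ := ((moveDist x y : ℕ) : ℝ) with hd
      -- With b = 1/(k-1) the initial modulus is at least 1 for all 1 ≤ d ≤ k, since d/2 ≤ k - 1
      -- when k ≥ 2.
      have h3 : 1 / ((k : ℝ) - 1) * (d * (d - 1) / 2) ≤ d - 1 := by
        rw [one_div, inv_mul_le_iff₀ hk1]
        nlinarith
      simp only [concaveCost, pow_zero, ← hd]
      linarith
  | succ t ih =>
    rw [Function.iterate_succ_apply', pow_succ, pow_succ, ← mul_assoc]
    refine stepOp_sub_le_concaveCost H hk0 hm0
      (mul_nonneg (by positivity) (pow_nonneg (by linarith) t)) ?_ (fun x y hx hy => ih hx hy) hx hy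
    rw [mul_right_comm, one_div, inv_mul_cancel₀ hk1.ne', one_mul]
    exact pow_le_pow_left₀ (by linarith) (by linarith) t

/-- The modulus lies below its chord at d = k, whose slope A - B is non-negative, so the bound at
distance k serves for all distances. -/
theorem moveDist_concaveCost_le (H : Regular δ γ) (hk : 2 ≤ k) (hm : 2 ≤ m) (t : ℕ)
    {x : Fin m → ℕ} (hx : IsState γ k x) (y : Fin m → ℕ) :
    concaveCost ((1 - rate δ k m) ^ t) (1 / (k - 1) * (1 - 2 * rate δ k m) ^ t) (moveDist x y)
      ≤ k * ((1 - rate δ k m) ^ t - 1 / 2 * (1 - 2 * rate δ k m) ^ t) := by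
  have hk0 : 0 < k := by omega
  have hm0 : 0 < m := by omega
  have hkR : (2 : ℝ) ≤ k := by exact_mod_cast hk
  have hmR : (2 : ℝ) ≤ m := by exact_mod_cast hm
  have hk1 : (0 : ℝ) < k - 1 := by linarith
  have hr0 := rate_nonneg (k := k) (m := m) H.pos
  have hr : rate δ k m ≤ 1 / 4 :=
    (rate_le H.le_one hk0 hm0).trans (one_div_le_one_div_of_le (by norm_num) (by nlinarith))
  have hb : 0 ≤ (1 - 2 * rate δ k m) ^ t := pow_nonneg (by linarith) t
  have hba : (1 - 2 * rate δ k m) ^ t ≤ (1 - rate δ k m) ^ t :=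
    pow_le_pow_left₀ (by linarith) (by linarith) t
  set B := (1 - 2 * rate δ k m) ^ t
  set A := (1 - rate δ k m) ^ t
  have hdk : (moveDist x y : ℝ) ≤ k := by exact_mod_cast moveDist_le hx y
  refine (concaveCost_le_tangent A (mul_nonneg (by positivity) hb) k _).trans ?_
  have e : 1 / ((k : ℝ) - 1) * B * (k - 1) = B := by field_simp
  have e' : 1 / ((k : ℝ) - 1) * B * (k * (k - 1) / 2) = k * B / 2 := by field_simp
  rw [e, e']
  nlinarith

/-! ### The transition matrix: stochasticity and reversibility -/

theorem mem_configs {η : Fin m → ℕ} : η ∈ configs m k ↔ ∑ i, η i = k := by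
  simp [configs]

theorem mem_state_iff (hQ : 0 < partitionFn γ k) {η : Fin m → ℕ} :
    η ∈ (configs m k).filter (fun η => nu γ k η ≠ 0) ↔ IsState γ k η := by
  rw [Finset.mem_filter, mem_configs, IsState]
  refine and_congr_right fun _ => ?_
  simp [nu, hQ.ne', Finset.prod_eq_zero_iff]

theorem State.isState (hQ : 0 < partitionFn γ k) (x : State γ k) : IsState γ k x.1 :=
  (mem_state_iff hQ).1 x.2

theorem nuState_nonneg (hQ : 0 < partitionFn γ k) (x : State γ k) : 0 ≤ nuState γ k x := by
  unfold nuState nu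
  positivity

theorem sum_nuState (hQ : 0 < partitionFn γ k) : ∑ x : State γ k, nuState γ k x = 1 := by
  have h1 : ∑ x : State γ k, nuState γ k x
      = ∑ η ∈ (configs m k).filter (fun η => nu γ k η ≠ 0), nu γ k η :=
    Finset.sum_coe_sort _ (nu γ k)
  rw [h1, Finset.sum_filter_ne_zero]
  simp only [nu, ← Finset.sum_div]
  exact div_self hQ.ne'

theorem jumpProb_eq (η : Fin m → ℕ) (i j : Fin m) :
    jumpProb δ γ k η i j = (η i : ℝ) ^ δ * acceptance δ γ η i j / (ell δ k m * m) := by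
  unfold jumpProb
  rw [div_mul_div_comm, mul_one, div_mul_eq_mul_div]

theorem jumpProb_eq_zero (hδ : 0 < δ) {η : Fin m → ℕ} {i : Fin m} (h : η i = 0) (j : Fin m) :
    jumpProb δ γ k η i j = 0 := by
  rw [jumpProb_eq, h]
  simp [hδ.ne']

theorem move_ne (η : Fin m → ℕ) {i j : Fin m} : move η i j ≠ η := by
  intro h
  have := congrFun h j
  simp [move] at this

theorem stepOp_eq (g : (Fin m → ℕ) → ℝ) (η : Fin m → ℕ) :
    stepOp δ γ k g η =
      g η + ∑ i, ∑ j, if i ≠ j then jumpProb δ γ k η i j * (g (move η i j) - g η) else 0 := by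
  unfold stepOp
  rw [Finset.sum_div]
  congr 1
  refine Finset.sum_congr rfl fun i _ => ?_
  rw [Finset.mul_sum, Finset.sum_div]
  refine Finset.sum_congr rfl fun j _ => ?_
  unfold incr
  split_ifs
  · rw [jumpProb_eq]; ring
  · simp

theorem transition_apply (x y : State γ k) :
    transition δ γ k x y
      = (if y = x then 1 - ∑ i, ∑ j, (if i ≠ j then jumpProb δ γ k x.1 i j else 0) else 0)
        + ∑ i, ∑ j, if i ≠ j then (if y.1 = move x.1 i j then jumpProb δ γ k x.1 i j else 0)
          else 0 := by
  unfold transition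
  by_cases h : y = x
  · subst h
    simp [(move_ne y.1).symm]
  · simp only [h, if_false, zero_add, ← ite_and]

/-- This links the matrix to the operator. Stochasticity then follows by applying the maximum
principle for `stepOp` to indicators and to the constant 1. -/
theorem sum_transition_mul (hQ : 0 < partitionFn γ k) (hδ : 0 < δ) (g : (Fin m → ℕ) → ℝ)
    (x : State γ k) : ∑ y, transition δ γ k x y * g y.1 = stepOp δ γ k g x.1 := by
  have hx := State.isState hQ x
  simp only [transition_apply, add_mul, Finset.sum_add_distrib, ite_mul, zero_mul,
    Finset.sum_ite_eq', Finset.mem_univ, if_true]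
  have h1 : ∑ y : State γ k, (∑ i, ∑ j, if i ≠ j then
      (if y.1 = move x.1 i j then jumpProb δ γ k x.1 i j else 0) else 0) * g y.1
      = ∑ i, ∑ j, if i ≠ j then jumpProb δ γ k x.1 i j * g (move x.1 i j) else 0 := by
    simp only [Finset.sum_mul]
    rw [Finset.sum_comm]
    refine Finset.sum_congr rfl fun i _ => ?_
    rw [Finset.sum_comm]
    refine Finset.sum_congr rfl fun j _ => ?_
    by_cases hij : i = j
    · simp [hij]
    simp only [if_pos (show i ≠ j from hij)]
    by_cases h0 : jumpProb δ γ k x.1 i j = 0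
    · simp [h0]
    have hst : IsState γ k (move x.1 i j) := by
      refine isState_move hx hij (fun h => h0 (jumpProb_eq_zero hδ h j)) (δ := δ) fun h => h0 ?_
      rw [jumpProb_eq, h]; simp
    rw [Finset.sum_eq_single (⟨move x.1 i j, (mem_state_iff hQ).2 hst⟩ : State γ k)]
    · simp
    · intro y _ hy
      rw [if_neg (fun h => hy (Subtype.ext h)), zero_mul]
    · simp
  rw [h1, stepOp_eq, sub_mul, one_mul, sub_add, sub_eq_add_neg]
  congr 1
  rw [Finset.sum_mul, ← Finset.sum_sub_distrib, ← Finset.sum_neg_distrib]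
  refine Finset.sum_congr rfl fun i _ => ?_
  rw [Finset.sum_mul, ← Finset.sum_sub_distrib, ← Finset.sum_neg_distrib]
  refine Finset.sum_congr rfl fun j _ => ?_
  split_ifs <;> ring

theorem isStochastic_transition (H : Regular δ γ) (hk : 0 < k) (hm : 0 < m)
    (hQ : 0 < partitionFn γ k) : IsStochastic (transition δ γ k) := by
  constructor
  · intro x y
    have h := sum_transition_mul (δ := δ) hQ H.pos (fun η => if η = y.1 then 1 else 0) x
    have e : ∑ z : State γ k, transition δ γ k x z * (if z.1 = y.1 then 1 else 0)
        = transition δ γ k x y := by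
      simp [Subtype.ext_iff.symm]
    rw [e] at h
    rw [h]
    refine le_stepOp hk hm H.pos H.le_one (fun z _ => ?_) (State.isState hQ x)
    split_ifs <;> simp
  · intro x
    have h := sum_transition_mul (δ := δ) hQ H.pos 1 x
    simp only [Pi.one_apply, mul_one] at h
    rw [h]
    exact le_antisymm
      (stepOp_le hk hm H.pos H.le_one (fun _ _ => le_rfl) (State.isState hQ x))
      (le_stepOp hk hm H.pos H.le_one (fun _ _ => le_rfl) (State.isState hQ x))

theorem rpow_mul_acceptance {τ : Fin m → ℕ} {i j : Fin m} (hij : i ≠ j)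
    (hi : IsState γ k (τ + unit i)) (hj : IsState γ k (τ + unit j)) :
    (γ i (τ i + 1) : ℝ) * (((τ + unit i) i : ℝ) ^ δ * acceptance δ γ (τ + unit i) i j)
      = γ i (τ i) * min (upRatio δ (γ i) (τ i)) (upRatio δ (γ j) (τ j)) := by
  have h0 : γ i (τ i) ≠ 0 := isState_add_unit_left hij hj
  have h1 : γ i (τ i + 1) ≠ 0 := by
    have := hi.2 i
    rwa [add_unit_self] at this
  have hp := upRatio_pos (δ := δ) h0 h1
  have e : (γ i (τ i) : ℝ) * upRatio δ (γ i) (τ i) = γ i (τ i + 1) * ((τ i : ℝ) + 1) ^ δ := by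
    unfold upRatio
    have : (γ i (τ i) : ℝ) ≠ 0 := by exact_mod_cast h0
    field_simp
  rw [acceptance_add_unit_self hij hi, add_unit_self]
  push_cast
  rw [← mul_assoc, ← e, mul_assoc, mul_min_of_nonneg _ _ hp.le, mul_one, mul_div_cancel₀ _ hp.ne']

/-- In terms of the common part τ, the flow is the weight of τ times the minimum of the two
up-ratios, up to a constant, hence symmetric in i and j. -/
theorem nu_mul_jumpProb {τ : Fin m → ℕ} {i j : Fin m} (hij : i ≠ j)
    (hi : IsState γ k (τ + unit i)) (hj : IsState γ k (τ + unit j)) :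
    nu γ k (τ + unit i) * jumpProb δ γ k (τ + unit i) i j
      = nu γ k (τ + unit j) * jumpProb δ γ k (τ + unit j) j i := by
  have key : ∀ {i j : Fin m}, i ≠ j → IsState γ k (τ + unit i) → IsState γ k (τ + unit j) →
      nu γ k (τ + unit i) * jumpProb δ γ k (τ + unit i) i j
        = (∏ l, (γ l (τ l) : ℝ)) * min (upRatio δ (γ i) (τ i)) (upRatio δ (γ j) (τ j))
          / (partitionFn γ k * (ell δ k m * m)) := by
    intro i j hij hi hj
    have h := rpow_mul_acceptance (δ := δ) hij hi hj
    have e : ∏ l, (γ l ((τ + unit i) l) : ℝ)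
        = γ i (τ i + 1) * ∏ l ∈ Finset.univ.erase i, (γ l (τ l) : ℝ) := by
      rw [← Finset.mul_prod_erase _ _ (Finset.mem_univ i), add_unit_self]
      congr 1
      exact Finset.prod_congr rfl fun l hl => by rw [add_unit_of_ne τ (Finset.ne_of_mem_erase hl)]
    rw [nu, jumpProb_eq, div_mul_div_comm, e, ← Finset.mul_prod_erase _ _ (Finset.mem_univ i)]
    congr 1
    linear_combination (∏ l ∈ Finset.univ.erase i, (γ l (τ l) : ℝ)) * h
  rw [key hij hi hj, key hij.symm hj hi, min_comm]

theorem isReversible_transition (hQ : 0 < partitionFn γ k) :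
    IsReversible (transition δ γ k) (nuState γ k) := by
  intro x y
  by_cases hxy : y = x
  · rw [hxy]
  have hx := State.isState hQ x
  have hy := State.isState hQ y
  rw [transition_apply, transition_apply, if_neg hxy, if_neg (Ne.symm hxy), zero_add, zero_add,
    Finset.mul_sum, Finset.mul_sum]
  simp only [Finset.mul_sum]
  rw [Finset.sum_comm]
  refine Finset.sum_congr rfl fun j _ => Finset.sum_congr rfl fun i _ => ?_
  by_cases hij : i = j
  · simp [hij]
  simp only [if_pos (show i ≠ j from hij), if_pos (show j ≠ i from Ne.symm hij)]
  have hne : ∀ {i j : Fin m}, i ≠ j → ∀ {x y : Fin m → ℕ}, IsState γ k x → IsState γ k y →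
      y = move x i j → ∃ τ, x = τ + unit i ∧ y = τ + unit j := by
    intro i j hij x y hx hy h
    -- With truncated subtraction, moving from an empty site would create a particle; the particle
    -- number excludes this.
    by_cases h0 : x i = 0
    · have : y = x + unit j := by
        rw [h]
        funext l
        by_cases hl : l = j
        · subst hl; simp [move]
        · by_cases hl' : l = i
          · subst hl'; simp [move, hl, h0]
          · simp [move, hl, hl']
      have h1 := hy.1
      rw [this, sum_add_unit, hx.1] at h1
      omega
    · obtain ⟨τ, rfl⟩ := exists_eq_add_unit h0
      exact ⟨τ, rfl, by rw [h, move_add_unit τ hij]⟩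
  by_cases h : y.1 = move x.1 i j
  · obtain ⟨τ, e1, e2⟩ := hne hij hx hy h
    have h' : x.1 = move y.1 j i := by rw [e2, move_add_unit τ (Ne.symm hij), e1]
    rw [if_pos h, if_pos h', nuState, nuState, e1, e2]
    exact nu_mul_jumpProb hij (e1 ▸ hx) (e2 ▸ hy)
  · rw [if_neg h, if_neg, mul_zero, mul_zero]
    intro h'
    obtain ⟨τ, e1, e2⟩ := hne (Ne.symm hij) hy hx h'
    exact h (by rw [e2, move_add_unit τ hij, e1])

theorem sum_pow_transition_mul (hQ : 0 < partitionFn γ k) (hδ : 0 < δ) (g : (Fin m → ℕ) → ℝ)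
    (t : ℕ) (x : State γ k) :
    ∑ y, (transition δ γ k ^ t) x y * g y.1 = (stepOp δ γ k)^[t] g x.1 := by
  induction t generalizing x with
  | zero => simp [Matrix.one_apply]
  | succ t ih =>
    rw [Function.iterate_succ_apply', ← sum_transition_mul hQ hδ, pow_succ']
    simp only [Matrix.mul_apply, Finset.sum_mul, ← ih, Finset.mul_sum]
    rw [Finset.sum_comm]
    simp only [mul_assoc]

theorem sum_nuState_mul_pow {P : Matrix (State γ k) (State γ k) ℝ} (hP : IsStochastic P)
    (hr : IsReversible P (nuState γ k)) (t : ℕ) (y : State γ k) :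
    ∑ z, nuState γ k z * (P ^ t) z y = nuState γ k y := by
  induction t generalizing y with
  | zero => simp [Matrix.one_apply]
  | succ t ih =>
    rw [pow_succ]
    simp only [Matrix.mul_apply, Finset.mul_sum, ← mul_assoc]
    rw [Finset.sum_comm]
    simp only [← Finset.sum_mul, ih]
    rw [Finset.sum_congr rfl fun z _ => hr z y, ← Finset.mul_sum, hP.2, mul_one]

/-! ### Total variation and the mixing time -/

theorem tvDist_eq {S : Type} [Fintype S] (a b : S → ℝ) (h : ∑ x, a x = ∑ x, b x) :
    tvDist a b = ∑ x, (a x - b x) * (if b x ≤ a x then 1 else 0) := by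
  have h1 : ∀ x, |a x - b x| = 2 * ((a x - b x) * (if b x ≤ a x then 1 else 0)) - (a x - b x) := by
    intro x
    split_ifs with h
    · rw [abs_of_nonneg (by linarith)]; ring
    · rw [abs_of_neg (by linarith)]; ring
  rw [tvDist, Finset.sum_congr rfl fun x _ => h1 x, Finset.sum_sub_distrib,
    Finset.sum_sub_distrib, h, ← Finset.mul_sum]
  ring

/-- The distance to equilibrium is bounded through the oscillation of the iterates of
`[0,1]`-valued functions. -/
theorem distToEq_le (H : Regular δ γ) (hk : 0 < k) (hm : 0 < m) (hQ : 0 < partitionFn γ k) (t : ℕ)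
    {r : ℝ} (hr0 : 0 ≤ r)
    (hr : ∀ g : (Fin m → ℕ) → ℝ, (∀ η, 0 ≤ g η ∧ g η ≤ 1) → ∀ x y, IsState γ k x →
      IsState γ k y → (stepOp δ γ k)^[t] g x - (stepOp δ γ k)^[t] g y ≤ r) :
    distToEq (transition δ γ k) (nuState γ k) t ≤ r := by
  refine Real.iSup_le (fun x => ?_) hr0
  have hst := isStochastic_transition H hk hm hQ
  have hrow : ∑ y, (transition δ γ k ^ t) x y = 1 := by
    have h := sum_pow_transition_mul hQ H.pos (fun _ => 1) t x
    simp only [mul_one] at h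
    rw [h]
    have : (stepOp δ γ k)^[t] (fun _ => (1 : ℝ)) = fun _ => 1 := by
      refine Function.iterate_fixed ?_ t
      funext η
      simp [stepOp, incr]
    rw [this]
  rw [tvDist_eq _ _ (hrow.trans (sum_nuState hQ).symm)]
  classical
  -- The indicator of the set where P^t(x, ·) ≥ ν attains the total variation. By stationarity the
  -- distance is then a ν-average of differences of the t-th iterate of g.
  set g : (Fin m → ℕ) → ℝ := fun η => if ∃ h : IsState γ k η,
    nuState γ k ⟨η, (mem_state_iff hQ).2 h⟩
      ≤ (transition δ γ k ^ t) x ⟨η, (mem_state_iff hQ).2 h⟩ then 1 else 0 with hg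
  have hgv : ∀ y : State γ k,
      (if nuState γ k y ≤ (transition δ γ k ^ t) x y then (1 : ℝ) else 0) = g y.1 := by
    intro y
    rw [hg]
    refine if_congr ⟨fun h => ⟨State.isState hQ y, h⟩, fun ⟨_, h⟩ => h⟩ rfl rfl
  have hg01 : ∀ η, 0 ≤ g η ∧ g η ≤ 1 := by
    intro η
    simp only [hg]
    split_ifs <;> simp
  have hstat : ∑ y, nuState γ k y * g y.1
      = ∑ z, nuState γ k z * (stepOp δ γ k)^[t] g z.1 := by
    simp only [← sum_pow_transition_mul hQ H.pos, Finset.mul_sum, ← mul_assoc]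
    rw [Finset.sum_comm]
    simp only [← Finset.sum_mul,
      sum_nuState_mul_pow hst (isReversible_transition hQ)]
  simp only [hgv, sub_mul, Finset.sum_sub_distrib]
  rw [hstat, sum_pow_transition_mul hQ H.pos]
  calc (stepOp δ γ k)^[t] g x.1 - ∑ z, nuState γ k z * (stepOp δ γ k)^[t] g z.1
      = ∑ z, nuState γ k z * ((stepOp δ γ k)^[t] g x.1 - (stepOp δ γ k)^[t] g z.1) := by
        simp only [mul_sub, Finset.sum_sub_distrib, ← Finset.sum_mul, sum_nuState hQ, one_mul]
    _ ≤ ∑ z, nuState γ k z * r := Finset.sum_le_sum fun z _ =>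
        mul_le_mul_of_nonneg_left (hr g hg01 _ _ (State.isState hQ x) (State.isState hQ z))
          (nuState_nonneg hQ z)
    _ = r := by rw [← Finset.sum_mul, sum_nuState hQ, one_mul]

theorem distToEq_le_pow (H : Regular δ γ) (hk : 0 < k) (hm : 0 < m) (hQ : 0 < partitionFn γ k)
    (t : ℕ) :
    distToEq (transition δ γ k) (nuState γ k) t ≤ k * (1 - rate δ k m) ^ t := by
  have h0 : 0 ≤ (1 - rate δ k m) ^ t :=
    pow_nonneg (sub_nonneg.2 (rate_le_one H.le_one hk hm)) t
  refine distToEq_le H hk hm hQ t (by positivity) fun g hg x y hx hy => ?_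
  have hl : NbrLip γ k 1 g := fun τ a b _ _ => by linarith [hg (τ + unit a), hg (τ + unit b)]
  refine ((nbrLip_iterate H hk hm hl t).sub_le H.logConcave hx hy).trans ?_
  rw [mul_comm]
  exact mul_le_mul_of_nonneg_right (by exact_mod_cast moveDist_le hx y) h0

theorem distToEq_le_exp (H : Regular δ γ) (hk : 2 ≤ k) (hm : 2 ≤ m) (hQ : 0 < partitionFn γ k)
    (t : ℕ) :
    distToEq (transition δ γ k) (nuState γ k) t
      ≤ k * Real.exp (-rate δ k m * (t + 1)) := by
  have hk0 : 0 < k := by omega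
  have hm0 : 0 < m := by omega
  have hkR : (2 : ℝ) ≤ k := by exact_mod_cast hk
  have hmR : (2 : ℝ) ≤ m := by exact_mod_cast hm
  have hr : rate δ k m ≤ 1 / 4 :=
    (rate_le H.le_one hk0 hm0).trans (one_div_le_one_div_of_le (by norm_num) (by nlinarith))
  refine distToEq_le H hk0 hm0 hQ t (by positivity) fun g hg x y hx hy => ?_
  refine (iterate_sub_le_concaveCost H hk hm (fun x y _ _ => by linarith [hg x, hg y]) t
    hx hy).trans ((moveDist_concaveCost_le H hk hm t hx y).trans ?_)
  exact mul_le_mul_of_nonneg_left (pow_sub_half_pow_le_exp (rate_pos H.pos hk0 hm0) hr t)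
    (by positivity)

theorem mixingBound_eq (ε : ℝ) :
    mixingBound δ k m ε = Real.log (k / ε) / rate δ k m := by
  unfold mixingBound rate
  rw [div_div_eq_mul_div]
  ring

theorem mixingBound_pos (H : Regular δ γ) (hk : 0 < k) (hm : 0 < m) {ε : ℝ} (h0 : 0 < ε)
    (h1 : ε < 1) : 0 < mixingBound δ k m ε := by
  rw [mixingBound_eq]
  refine div_pos (Real.log_pos ?_) (rate_pos H.pos hk hm)
  have : (1 : ℝ) ≤ k := by exact_mod_cast hk
  rw [one_lt_div h0]
  linarith

theorem mul_exp_le_of_mixingBound_le (hδ : 0 < δ) (hk : 0 < k) (hm : 0 < m) {ε : ℝ} (h0 : 0 < ε)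
    {s : ℝ} (hs : mixingBound δ k m ε ≤ s) : k * Real.exp (-rate δ k m * s) ≤ ε := by
  have hkR : (0 : ℝ) < k := by exact_mod_cast hk
  have hr := rate_pos hδ hk hm
  rw [mixingBound_eq, div_le_iff₀ hr] at hs
  have : Real.exp (-rate δ k m * s) ≤ Real.exp (-Real.log (k / ε)) :=
    Real.exp_le_exp.2 (by linarith)
  rw [Real.exp_neg, Real.exp_log (by positivity), inv_div, le_div_iff₀ hkR] at this
  linarith

theorem distToEq_le_of_mixingBound_le (H : Regular δ γ) (hk : 0 < k) (hm : 0 < m)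
    (hQ : 0 < partitionFn γ k) {ε : ℝ} (h0 : 0 < ε) {t : ℕ} (ht : mixingBound δ k m ε ≤ t) :
    distToEq (transition δ γ k) (nuState γ k) t ≤ ε := by
  refine (distToEq_le_pow H hk hm hQ t).trans ?_
  refine le_trans ?_ (mul_exp_le_of_mixingBound_le H.pos hk hm h0 ht)
  refine mul_le_mul_of_nonneg_left ?_ (by positivity)
  rw [mul_comm, Real.exp_nat_mul]
  refine pow_le_pow_left₀ (sub_nonneg.2 (rate_le_one H.le_one hk hm)) ?_ t
  linarith [Real.add_one_le_exp (-rate δ k m)]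

/-- The factor e^(-κ(t+1)) needs only B_ε ≤ t + 1, which holds at the integer part of B_ε. For m = 1
there is a single state. -/
theorem distToEq_floor_le (H : Regular δ γ) (hk : 2 ≤ k) (hm : 0 < m)
    (hQ : 0 < partitionFn γ k) {ε : ℝ} (h0 : 0 < ε) :
    distToEq (transition δ γ k) (nuState γ k) ⌊mixingBound δ k m ε⌋₊ ≤ ε := by
  rcases Nat.lt_or_ge m 2 with hm2 | hm2
  · obtain rfl : m = 1 := by omega
    refine distToEq_le H (by omega) hm hQ _ h0.le fun g _ x y hx hy => ?_
    have : x = y := by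
      funext i
      have h1 := hx.1.trans hy.1.symm
      rw [Fin.sum_univ_one, Fin.sum_univ_one] at h1
      rw [Subsingleton.elim i 0, h1]
    rw [this, sub_self]
    exact h0.le
  · exact (distToEq_le_exp H hk hm2 hQ _).trans
      (mul_exp_le_of_mixingBound_le H.pos (by omega) hm h0 (Nat.lt_floor_add_one _).le)

end LogConcaveChain

end

theorem theorem2 (m k : ℕ) (hm : 0 < m) (hk : 0 < k) (γ : Fin m → ℕ → NNReal)
    (hγ : ∀ j, LogConcaveChain.LogConcave (γ j))
    (hQ : 0 < LogConcaveChain.partitionFn γ k)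
    (δ : ℝ) (hδ : δ = LogConcaveChain.concavityIndex γ) (hδ0 : 0 < δ) :
    LogConcaveChain.IsStochastic (LogConcaveChain.transition δ γ k) ∧
    LogConcaveChain.IsReversible (LogConcaveChain.transition δ γ k)
      (LogConcaveChain.nuState γ k) ∧
    ∀ ε : ℝ, 0 < ε → ε < 1 →
      (∀ t : ℕ, LogConcaveChain.mixingBound δ k m ε ≤ t →
        LogConcaveChain.distToEq (LogConcaveChain.transition δ γ k)
          (LogConcaveChain.nuState γ k) t ≤ ε) ∧
      LogConcaveChain.mixingTime (LogConcaveChain.transition δ γ k)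
        (LogConcaveChain.nuState γ k) ε ≤ ⌈LogConcaveChain.mixingBound δ k m ε⌉₊ ∧
      (2 ≤ k →
        (LogConcaveChain.mixingTime (LogConcaveChain.transition δ γ k)
          (LogConcaveChain.nuState γ k) ε : ℝ) ≤ LogConcaveChain.mixingBound δ k m ε) := by
  have hmem := (LogConcaveChain.isGreatest_concavityIndex hγ).1
  rw [← hδ] at hmem
  have H : LogConcaveChain.Regular δ γ := ⟨hγ, hmem.2, hδ0, hmem.1.2⟩
  refine ⟨LogConcaveChain.isStochastic_transition H hk hm hQ,
    LogConcaveChain.isReversible_transition hQ, fun ε h0 h1 => ⟨fun t ht =>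
      LogConcaveChain.distToEq_le_of_mixingBound_le H hk hm hQ h0 ht, Nat.sInf_le
      (LogConcaveChain.distToEq_le_of_mixingBound_le H hk hm hQ h0 (Nat.le_ceil _)), fun hk2 => ?_⟩⟩
  exact (Nat.cast_le.2 (Nat.sInf_le
    (LogConcaveChain.distToEq_floor_le H hk2 hm hQ h0))).trans
    (Nat.floor_le (LogConcaveChain.mixingBound_pos H hk hm h0 h1).le)
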